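/- There is a family $(\gamma_L)_{L\ge 1}$ of smooth Riemannian metrics on the sphere $S^2=\{x\in\mathbb R^3 : |x|=1\}$ such that, for every $L\ge 1$, $\gamma_L$ has positive Gauss curvature and area $4\pi$, and is a rotationally symmetric conformal metric, i.e. $\gamma_L=f_L(x_3)\,g_{\mathrm{round}}$ for some function $f_L$, where $g_{\mathrm{round}}$ is the standard round metric; and such that, for every $\alpha\ge 0$, $$\lambda_1^{\alpha}(S^2,\gamma_L)=O(L^{-1}),$$ i.e. there is a constant $C=C(\alpha)$ with $|\lambda_1^{\alpha}(S^2,\gamma_L)|\le C/L$ for all $L\ge 1$. Here $\lambda_0^{\alpha}(S^2,\gamma)<\lambda_1^{\alpha}(S^2,\gamma)\le\lambda_2^{\alpha}(S^2,\gamma)\le\cdots$ denote the eigenvalues, repeated according to multiplicity, of the operator $-\Delta_\gamma+\alpha K_\gamma$ acting on smooth functions on $S^2$, where $\Delta_\gamma$ is the Laplace–Beltrami operator and $K_\gamma$ the Gauss curvature of $\gamma$. -/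

import Mathlib

open scoped Manifold ContDiff

noncomputable section

namespace SurfaceGeometry

/-- The coordinate plane `ℝ²`. -/
abbrev Plane : Type := EuclideanSpace ℝ (Fin 2)

/-- The ambient space `ℝ³`. -/
abbrev Space : Type := EuclideanSpace ℝ (Fin 3)

/-- The two-sphere `S²`, with Mathlib's smooth structure (stereographic charts). -/
abbrev S2 : Type := Metric.sphere (0 : Space) 1

/-- Smooth (`C^∞`) Riemannian metrics on `S²`. -/
abbrev RiemMetric : Type :=
  Bundle.ContMDiffRiemannianMetric (𝓡 2) ∞ Plane (fun x : S2 ↦ TangentSpace (𝓡 2) x)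

/-! ### Riemannian geometry in local coordinates

`G y i j` are the coefficients `g_ij(y)` of a metric in a coordinate chart. -/

/-- The partial derivative `∂_i f (y)`. -/
def partialD (i : Fin 2) (f : Plane → ℝ) (y : Plane) : ℝ :=
  fderiv ℝ f y (EuclideanSpace.single i 1)

/-- The Christoffel symbols
`Γ^k_ij = ½ ∑_l g^kl (∂_i g_jl + ∂_j g_il - ∂_l g_ij)`. -/
def christoffel (G : Plane → Matrix (Fin 2) (Fin 2) ℝ) (k i j : Fin 2) (y : Plane) : ℝ :=
  (1 / 2) * ∑ l, (G y)⁻¹ k l *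
    (partialD i (fun z ↦ G z j l) y + partialD j (fun z ↦ G z i l) y
      - partialD l (fun z ↦ G z i j) y)

/-- The component `R^l` in `R(∂_i, ∂_j) ∂_k = ∑_l R^l ∂_l`, where
`R(X, Y) Z = ∇_X ∇_Y Z - ∇_Y ∇_X Z - ∇_[X,Y] Z`. -/
def riemannCoeff (G : Plane → Matrix (Fin 2) (Fin 2) ℝ) (l i j k : Fin 2) (y : Plane) : ℝ :=
  partialD i (christoffel G l j k) y - partialD j (christoffel G l i k) y
    + ∑ m, (christoffel G l i m y * christoffel G m j k y
        - christoffel G l j m y * christoffel G m i k y)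

/-- The Gauss curvature `g(R(∂_0, ∂_1) ∂_1, ∂_0) / det g` in coordinates. -/
def coordGaussCurvature (G : Plane → Matrix (Fin 2) (Fin 2) ℝ) (y : Plane) : ℝ :=
  (∑ l, G y 0 l * riemannCoeff G l 0 1 1 y) / (G y).det

/-- The Laplace–Beltrami operator
`Δ f = (det g)^(-1/2) ∑_ij ∂_i ((det g)^(1/2) g^ij ∂_j f)` in coordinates. -/
def coordLaplacian (G : Plane → Matrix (Fin 2) (Fin 2) ℝ) (f : Plane → ℝ) (y : Plane) : ℝ :=
  (1 / Real.sqrt (G y).det) *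
    ∑ i, partialD i
      (fun z ↦ ∑ j, Real.sqrt (G z).det * (G z)⁻¹ i j * partialD j f z) y

/-! ### Riemannian metrics on the two-sphere -/

/-- The matrix `g_ij(y) = g(∂_i, ∂_j)` of the metric in the stereographic chart centred at `p`.
This chart is defined on `S² \ {-p}` and its image is the whole plane. -/
def gram (g : RiemMetric) (p : S2) (y : Plane) : Matrix (Fin 2) (Fin 2) ℝ :=
  Matrix.of fun i j ↦
    g.inner ((extChartAt (𝓡 2) p).symm y)
      (mfderiv 𝓘(ℝ, Plane) (𝓡 2) (extChartAt (𝓡 2) p).symm y (EuclideanSpace.single i (1 : ℝ)))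
      (mfderiv 𝓘(ℝ, Plane) (𝓡 2) (extChartAt (𝓡 2) p).symm y (EuclideanSpace.single j (1 : ℝ)))

/-- The Gauss curvature of `(S², g)`. -/
def gaussCurvature (g : RiemMetric) (p : S2) : ℝ :=
  coordGaussCurvature (gram g p) (extChartAt (𝓡 2) p p)

/-- The Laplace–Beltrami operator of `(S², g)`. -/
def laplacian (g : RiemMetric) (u : S2 → ℝ) (p : S2) : ℝ :=
  coordLaplacian (gram g p) (fun y ↦ u ((extChartAt (𝓡 2) p).symm y)) (extChartAt (𝓡 2) p p)

/-- The point `(0, 0, 1)` of `S²`. -/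
def northPole : S2 := ⟨EuclideanSpace.single 2 1, by simp⟩

/-- The area of `(S², g)`: the integral of `(det g)^(1/2)` over the stereographic chart centred at
the north pole, which covers `S²` except for a single point. -/
def area (g : RiemMetric) : ENNReal :=
  ∫⁻ y : Plane, ENNReal.ofReal (Real.sqrt (gram g northPole y).det)

/-- The metric has the form `f(x₃) g_round`, where `g_round` is the metric that the unit sphere
inherits from `ℝ³`: it is conformal to the round metric and invariant under rotations about the
`x₃`-axis. -/
def IsRotationallySymmetricConformal (g : RiemMetric) : Prop :=
  ∃ f : ℝ → ℝ, ∀ (p : S2) (v w : TangentSpace (𝓡 2) p),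
    g.inner p v w = f ((p : Space) 2) *
      inner (E := Space) ℝ (mfderiv (𝓡 2) 𝓘(ℝ, Space) ((↑) : S2 → Space) p v)
        (mfderiv (𝓡 2) 𝓘(ℝ, Space) ((↑) : S2 → Space) p w)

/-- `u` is a smooth function with `-Δ u + α K u = μ u` on `(S², g)`. -/
def SolvesEigenEquation (g : RiemMetric) (α μ : ℝ) (u : S2 → ℝ) : Prop :=
  ContMDiff (𝓡 2) 𝓘(ℝ, ℝ) ∞ u ∧
    ∀ p, -laplacian g u p + α * gaussCurvature g p * u p = μ * u p

/-- The eigenvalue `λ_k`, `k = 0, 1, 2, …`, of `-Δ + α K` on `(S², g)`, where the eigenvalues are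
listed in increasing order and repeated according to multiplicity: the least `Λ` for which there
are `k + 1` linearly independent eigenfunctions with eigenvalues at most `Λ`.
(The value would be `⊤` if there were no such `Λ`.) -/
def eigenvalue (g : RiemMetric) (α : ℝ) (k : ℕ) : EReal :=
  sInf {Λ : EReal | ∃ (μ : Fin (k + 1) → ℝ) (u : Fin (k + 1) → S2 → ℝ),
    LinearIndependent ℝ u ∧ ∀ i, SolvesEigenEquation g α (μ i) (u i) ∧ (μ i : EReal) ≤ Λ}

end SurfaceGeometry

end

/-!
The metrics are the King–Rosenau "sausages" `f(x₃) g_round` with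
`f(x) = tanh a / (a (1 - tanh² a · x²))` and `a = L`. In the cylindrical coordinates `x₃ = tanh t`
such a sausage is close, for `|t| ≤ a / 2`, to the flat cylinder `(dt² + dθ²) / a`, and nearly all
of its curvature sits in two caps. Area and curvature are explicit: the area is `4π`, and
`K f = (1 - T²) (1 + T² x²) / (1 - T² x²)² > 0` with `T = tanh a`.

Since `K > 0` and `α ≥ 0`, every eigenvalue of `-Δ + α K` is nonnegative, by the maximum principle
(`nonneg_of_solvesEigenEquation`). It remains to find two independent eigenfunctions with
eigenvalues at most `C / a` (`exists_two_eigenfunctions`). They are sought among the zonal functions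
`U(x₃)`, for which the eigenvalue equation is the singular Sturm–Liouville equation
`((1 - x²) U')' = (α K f - μ f) U` on `[-1, 1]`.

The solution that is regular at the pole `x = 1` exists, is smooth and depends continuously on `μ`,
because it solves a Volterra equation (`exists_volterra_solution`, `exists_regular_solutions`). For
`μ = 0` it is positive on the hemisphere `[0, 1]` (`pos_of_nonneg_potential`). For `μ = C / a` with
`C = 16 π² + 32 α` it is not: in the variable `t` the equation reads `u'' + Q u = 0` with
`Q ≥ (2 π / a)²` on the interval `[0, a / 2]` (`lower_bound_potential`), so Sturm comparison with
`sin (2 π t / a)` applies (`exists_nonpos_of_oscillation`). By the intermediate value theorem some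
`μ₁ ≤ C / a` has a solution that vanishes at the equator, and some `μ₀ ≤ μ₁` one whose derivative
vanishes there (`exists_even_and_odd_solution`). Reflection in the equator turns them into an odd
and an even eigenfunction.

The geometric quantities are computed in the stereographic chart centred at the point in question,
where every metric `φ g_round` is conformal to the flat one.
-/

noncomputable section

namespace SurfaceGeometry

/-! ### Metrics conformal to the round metric -/

section Geometry

open Bundle

theorem fact_finrank_space : Fact (Module.finrank ℝ Space = 2 + 1) :=
  ⟨finrank_euclideanSpace_fin⟩

attribute [local instance] fact_finrank_space

/-- The differential of the inclusion `S² ⊂ ℝ³` at `p`. The tangent space is replaced by its model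
`Plane`, to which it is definitionally equal, so that operator norms are available. -/
def coeDeriv (p : S2) : Plane →L[ℝ] Space :=
  mfderiv (𝓡 2) 𝓘(ℝ, Space) ((↑) : S2 → Space) p

/-- The bilinear form `φ(p) ⟨v, w⟩` on `T_p S²`, with `T_p S²` again replaced by `Plane`. -/
def conformalForm (φ : S2 → ℝ) (p : S2) : Plane →L[ℝ] Plane →L[ℝ] ℝ :=
  φ p • (innerSL ℝ (E := Space)).bilinearComp (coeDeriv p) (coeDeriv p)

theorem conformalForm_apply (φ : S2 → ℝ) (p : S2) (v w : Plane) :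
    conformalForm φ p v w = φ p * inner ℝ (coeDeriv p v) (coeDeriv p w) := rfl

theorem coeDeriv_injective (p : S2) : Function.Injective (coeDeriv p) :=
  injective_mvfderiv_subtypeVal_sphere (n := 2) p

/-- In the trivialization around `p₀` the form is a polynomial expression in `φ` and in the
differential of the inclusion, both of which are smooth there. -/
theorem contMDiff_conformalForm {φ : S2 → ℝ} (hφ : ContMDiff (𝓡 2) 𝓘(ℝ, ℝ) ∞ φ) :
    ContMDiff (𝓡 2) ((𝓡 2).prod 𝓘(ℝ, Plane →L[ℝ] Plane →L[ℝ] ℝ)) ∞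
      (fun p : S2 ↦ TotalSpace.mk' (Plane →L[ℝ] Plane →L[ℝ] ℝ)
        (E := fun p : S2 ↦ TangentSpace (𝓡 2) p →L[ℝ] TangentSpace (𝓡 2) p →L[ℝ] ℝ)
        p (conformalForm φ p)) := by
  intro p₀
  rw [contMDiffAt_hom_bundle]
  refine ⟨contMDiffAt_id, ?_⟩
  have hD : ContMDiffAt (𝓡 2) 𝓘(ℝ, Plane →L[ℝ] Space) ∞
      (inTangentCoordinates (𝓡 2) 𝓘(ℝ, Space) id ((↑) : S2 → Space)
        (mfderiv (𝓡 2) 𝓘(ℝ, Space) ((↑) : S2 → Space)) p₀) p₀ :=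
    ContMDiffAt.mfderiv_const (n := ∞) (contMDiff_coe_sphere (n := 2) p₀) (by simp)
  set D := inTangentCoordinates (𝓡 2) 𝓘(ℝ, Space) id ((↑) : S2 → Space)
        (mfderiv (𝓡 2) 𝓘(ℝ, Space) ((↑) : S2 → Space)) p₀ with hDdef
  have hB : ContDiff ℝ ∞ (fun A : ℝ × (Plane →L[ℝ] Space) ↦
      A.1 • (((ContinuousLinearMap.compL ℝ Plane Space ℝ).flip A.2).comp
        (innerSL ℝ (E := Space))).comp A.2) := by
    fun_prop
  have := hB.contMDiff.contMDiffAt.comp p₀ ((hφ p₀).prodMk_space hD)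
  refine this.congr_of_eventuallyEq ?_
  have : ∀ᶠ p in nhds p₀, p ∈ (trivializationAt Plane (TangentSpace (𝓡 2)) p₀).baseSet :=
    (trivializationAt Plane (TangentSpace (𝓡 2)) p₀).open_baseSet.mem_nhds
      (FiberBundle.mem_baseSet_trivializationAt' p₀)
  filter_upwards [this] with p hp
  have key : ∀ v : Plane, D p v =
      coeDeriv p ((trivializationAt Plane (TangentSpace (𝓡 2)) p₀).symm p v) := by
    intro v
    simp only [hDdef, inTangentCoordinates, ContinuousLinearMap.inCoordinates]
    rw [TangentBundle.continuousLinearMapAt_model_space]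
    exact congrArg (coeDeriv p) (Trivialization.symmL_apply _ hp v)
  ext v w
  refine (inCoordinates_apply_eq₂ hp hp (by simp)).trans ?_
  simp [key]
  rfl

theorem isVonNBounded_conformalForm {φ : S2 → ℝ} {p : S2} (hp : 0 < φ p) :
    Bornology.IsVonNBounded ℝ {v : Plane | conformalForm φ p v v < 1} := by
  obtain ⟨K, -, hK⟩ := (coeDeriv p).toLinearMap.exists_antilipschitzWith
    (LinearMap.ker_eq_bot.2 (coeDeriv_injective p))
  rw [NormedSpace.isVonNBounded_iff, isBounded_iff_forall_norm_le]
  refine ⟨K * Real.sqrt (1 / φ p), fun v hv ↦ ?_⟩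
  have h1 : φ p * ‖coeDeriv p v‖ ^ 2 < 1 := by
    simpa [conformalForm_apply, real_inner_self_eq_norm_sq] using hv
  have h2 : ‖v‖ ≤ K * ‖coeDeriv p v‖ := hK.le_mul_norm (map_zero _) v
  refine h2.trans (mul_le_mul_of_nonneg_left (Real.le_sqrt_of_sq_le ?_) K.2)
  rw [le_div_iff₀ hp]
  linarith

/-- The Riemannian metric `φ · g_round`, for a smooth positive function `φ` on `S²`. -/
def conformalMetric (φ : S2 → ℝ) (hφ : ContMDiff (𝓡 2) 𝓘(ℝ, ℝ) ∞ φ) (hpos : ∀ p, 0 < φ p) :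
    RiemMetric where
  inner := conformalForm φ
  symm p v w := congrArg (φ p * ·) (real_inner_comm (coeDeriv p w) (coeDeriv p v))
  pos p _ hv := mul_pos (hpos p) (real_inner_self_pos.2 fun h ↦
    hv (coeDeriv_injective p (h.trans (map_zero (coeDeriv p)).symm)))
  isVonNBounded p := isVonNBounded_conformalForm (hpos p)
  contMDiff := contMDiff_conformalForm hφ

/-! ### Stereographic charts -/

/-- The inverse of the stereographic chart centred at `p`, with `J` an isometry of the coordinate
plane onto the tangent plane `p^⊥`. -/
theorem exists_chart_symm_eq (p : S2) : ∃ J : Plane →ₗᵢ[ℝ] Space,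
    (∀ y, inner ℝ (J y) (p : Space) = 0) ∧
    ∀ y, (((extChartAt (𝓡 2) p).symm y : S2) : Space) =
      (‖y‖ ^ 2 + 4)⁻¹ • ((4 : ℝ) • J y + (4 - ‖y‖ ^ 2) • (p : Space)) := by
  let U : (ℝ ∙ ((-p : S2) : Space))ᗮ ≃ₗᵢ[ℝ] Plane :=
    (OrthonormalBasis.fromOrthogonalSpanSingleton 2 (ne_zero_of_mem_unit_sphere (-p))).repr
  refine ⟨(ℝ ∙ ((-p : S2) : Space))ᗮ.subtypeₗᵢ.comp U.symm.toLinearIsometry, fun y ↦ ?_, fun y ↦ ?_⟩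
  · have h := (U.symm y).2
    rw [Submodule.mem_orthogonal_singleton_iff_inner_left] at h
    have h' : inner ℝ (U.symm y : Space) (p : Space) = 0 := by simpa using h
    exact h'
  · have h1 : (((extChartAt (𝓡 2) p).symm y : S2) : Space) =
      ((stereographic' 2 (-p)).symm y : Space) := rfl
    have h2 : ‖(U.symm y : Space)‖ = ‖y‖ := U.symm.norm_map y
    rw [h1, stereographic'_symm_apply]
    change (‖(U.symm y : Space)‖ ^ 2 + 4)⁻¹ • (4 : ℝ) • (U.symm y : Space) +
      (‖(U.symm y : Space)‖ ^ 2 + 4)⁻¹ • (‖(U.symm y : Space)‖ ^ 2 - 4) • ((-p : S2) : Space) = _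
    rw [h2]
    simp only [coe_neg_sphere]
    have h3 (w q : Space) (c n : ℝ) : c • (4 : ℝ) • w + c • (n - 4) • (-q) =
      c • ((4 : ℝ) • w + (4 - n) • q) := by module
    exact h3 _ _ _ _

theorem extChartAt_target_eq_univ (p : S2) : (extChartAt (𝓡 2) p).target = Set.univ := by
  rw [extChartAt_target]
  have : (chartAt Plane p).target = Set.univ := stereographic'_target (-p)
  simp [this]

theorem chart_symm_zero (p : S2) : (extChartAt (𝓡 2) p).symm 0 = p := by
  obtain ⟨J, -, hJ⟩ := exists_chart_symm_eq p
  ext1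
  rw [hJ]
  simp

theorem extChartAt_self (p : S2) : extChartAt (𝓡 2) p p = 0 := by
  have h := (extChartAt (𝓡 2) p).right_inv (x := 0) (by rw [extChartAt_target_eq_univ]; trivial)
  rwa [chart_symm_zero] at h

theorem contMDiff_chart_symm (p : S2) :
    ContMDiff 𝓘(ℝ, Plane) (𝓡 2) ∞ (extChartAt (𝓡 2) p).symm := by
  have h := contMDiffOn_extChartAt_symm (I := 𝓡 2) (n := ∞) p
  rwa [extChartAt_target_eq_univ, contMDiffOn_univ] at h

theorem coeDeriv_chart_symm (p : S2) (y v : Plane) :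
    coeDeriv ((extChartAt (𝓡 2) p).symm y)
      (mfderiv 𝓘(ℝ, Plane) (𝓡 2) (extChartAt (𝓡 2) p).symm y v) =
    fderiv ℝ (fun z ↦ (((extChartAt (𝓡 2) p).symm z : S2) : Space)) y v := by
  have h1 : MDifferentiableAt (𝓡 2) 𝓘(ℝ, Space) ((↑) : S2 → Space) ((extChartAt (𝓡 2) p).symm y) :=
    (contMDiff_coe_sphere (n := 2) (m := ∞) _).mdifferentiableAt (by simp)
  have h2 : MDifferentiableAt 𝓘(ℝ, Plane) (𝓡 2) (extChartAt (𝓡 2) p).symm y :=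
    (contMDiff_chart_symm p y).mdifferentiableAt (by simp)
  have := mfderiv_comp y h1 h2
  rw [mfderiv_eq_fderiv] at this
  exact (DFunLike.congr_fun this v).symm

/-- The round metric is `16 / (|y|² + 4)²` times the flat one in every stereographic chart. -/
theorem inner_fderiv_chart_symm (p : S2) (y v w : Plane) :
    inner ℝ (fderiv ℝ (fun z ↦ (((extChartAt (𝓡 2) p).symm z : S2) : Space)) y v)
      (fderiv ℝ (fun z ↦ (((extChartAt (𝓡 2) p).symm z : S2) : Space)) y w) =
    16 / (‖y‖ ^ 2 + 4) ^ 2 * inner ℝ v w := by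
  obtain ⟨J, hJp, hJ⟩ := exists_chart_symm_eq p
  have hD : ‖y‖ ^ 2 + 4 ≠ 0 := by positivity
  have hn : HasFDerivAt (fun z : Plane ↦ ‖z‖ ^ 2) (2 • innerSL ℝ y) y :=
    (hasStrictFDerivAt_norm_sq y).hasFDerivAt
  have hN := ((J.toContinuousLinearMap.hasFDerivAt (x := y)).const_smul (4 : ℝ)).add
    ((hn.const_sub 4).smul_const (p : Space))
  have hF := ((hasDerivAt_inv hD).comp_hasFDerivAt y (hn.add_const 4)).smul hN
  have e (v : Plane) : fderiv ℝ (fun z ↦ (((extChartAt (𝓡 2) p).symm z : S2) : Space)) y v =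
      (‖y‖ ^ 2 + 4)⁻¹ • ((4 : ℝ) • J v - (2 * inner ℝ y v) • (p : Space)
        - (2 * inner ℝ y v * (‖y‖ ^ 2 + 4)⁻¹) • ((4 : ℝ) • J y + (4 - ‖y‖ ^ 2) • (p : Space))) := by
    rw [funext hJ]
    refine (DFunLike.congr_fun (HasFDerivAt.fderiv hF) v).trans ?_
    simp [← inv_pow]
    module
  have hpp : inner ℝ (p : Space) (p : Space) = (1 : ℝ) := by
    simp
  have hpJ (z) : inner ℝ (p : Space) (J z) = 0 := by rw [real_inner_comm]; exact hJp z
  rw [e, e]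
  simp only [inner_smul_left, inner_smul_right, inner_sub_left, inner_sub_right, inner_add_left,
    inner_add_right, hJp, hpJ, hpp, J.inner_map_map, real_inner_self_eq_norm_sq,
    real_inner_comm y, RCLike.conj_to_real]
  field_simp
  ring

theorem gram_conformalMetric {φ : S2 → ℝ} (hφ : ContMDiff (𝓡 2) 𝓘(ℝ, ℝ) ∞ φ)
    (hpos : ∀ p, 0 < φ p) (p : S2) (y : Plane) :
    gram (conformalMetric φ hφ hpos) p y =
      (φ ((extChartAt (𝓡 2) p).symm y) * (16 / (‖y‖ ^ 2 + 4) ^ 2)) •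
        (1 : Matrix (Fin 2) (Fin 2) ℝ) := by
  ext i j
  have h : gram (conformalMetric φ hφ hpos) p y i j = φ ((extChartAt (𝓡 2) p).symm y) *
      inner ℝ (coeDeriv ((extChartAt (𝓡 2) p).symm y)
        (mfderiv 𝓘(ℝ, Plane) (𝓡 2) (extChartAt (𝓡 2) p).symm y (EuclideanSpace.single i (1 : ℝ))))
       (coeDeriv ((extChartAt (𝓡 2) p).symm y)
        (mfderiv 𝓘(ℝ, Plane) (𝓡 2) (extChartAt (𝓡 2) p).symm y
          (EuclideanSpace.single j (1 : ℝ)))) := rfl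
  rw [h, coeDeriv_chart_symm, coeDeriv_chart_symm, inner_fderiv_chart_symm]
  have h1 : inner ℝ (EuclideanSpace.single i (1 : ℝ) : Plane) (EuclideanSpace.single j (1 : ℝ)) =
      (1 : Matrix (Fin 2) (Fin 2) ℝ) i j := by
    simp [Matrix.one_apply, EuclideanSpace.inner_single_left]
  rw [h1, Matrix.smul_apply, smul_eq_mul, mul_assoc]

theorem isRotationallySymmetricConformal_conformalMetric {φ : S2 → ℝ}
    (hφ : ContMDiff (𝓡 2) 𝓘(ℝ, ℝ) ∞ φ) (hpos : ∀ p, 0 < φ p) (f : ℝ → ℝ)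
    (hf : ∀ p, φ p = f ((p : Space) 2)) :
    IsRotationallySymmetricConformal (conformalMetric φ hφ hpos) :=
  ⟨f, fun p v w ↦ by rw [← hf]; rfl⟩

/-! ### Curvature and Laplacian of conformal metrics -/

/-- The Laplacian `∂₀² + ∂₁²` of the flat plane. -/
def flatLaplacian (F : Plane → ℝ) (y : Plane) : ℝ :=
  ∑ i, partialD i (partialD i F) y

/-- In dimension two `√(det g) g^ij = δ^ij` for a metric conformal to the flat one, so that its
Laplacian is a multiple of the flat Laplacian. -/
theorem coordLaplacian_smul_one {c : Plane → ℝ} (hc : ∀ y, 0 < c y) (F : Plane → ℝ) (y : Plane) :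
    coordLaplacian (fun z ↦ c z • (1 : Matrix (Fin 2) (Fin 2) ℝ)) F y =
      (c y)⁻¹ * flatLaplacian F y := by
  have hdet (z) : Real.sqrt (c z • (1 : Matrix (Fin 2) (Fin 2) ℝ)).det = c z := by
    simp [Real.sqrt_sq (hc z).le]
  have hinv (z) : (c z • (1 : Matrix (Fin 2) (Fin 2) ℝ))⁻¹ = (c z)⁻¹ • 1 := by
    apply Matrix.inv_eq_left_inv
    simp [smul_smul, (hc z).ne']
  have h (i) : (fun z ↦ ∑ j, Real.sqrt (c z • (1 : Matrix (Fin 2) (Fin 2) ℝ)).det *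
      (c z • (1 : Matrix (Fin 2) (Fin 2) ℝ))⁻¹ i j * partialD j F z) = partialD i F := by
    funext z
    simp only [hdet, hinv]
    simp [Matrix.one_apply, (hc z).ne']
  simp only [coordLaplacian, h]
  rw [hdet, flatLaplacian, one_div]

/-- With `c = e^{2w}` this is `K = -e^{-2w} Δw`. -/
theorem coordGaussCurvature_smul_one {c : Plane → ℝ} (hc : ∀ y, 0 < c y) (hd : Differentiable ℝ c)
    (y : Plane) :
    coordGaussCurvature (fun z ↦ c z • (1 : Matrix (Fin 2) (Fin 2) ℝ)) y =
      -(c y)⁻¹ * flatLaplacian (fun z ↦ Real.log (c z) / 2) y := by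
  have hch : christoffel (fun z ↦ c z • (1 : Matrix (Fin 2) (Fin 2) ℝ)) = fun k i j y ↦
      (if j = k then partialD i (fun z ↦ Real.log (c z) / 2) y else 0) +
      (if i = k then partialD j (fun z ↦ Real.log (c z) / 2) y else 0)
       - (if i = j then partialD k (fun z ↦ Real.log (c z) / 2) y else 0) := by
    funext k i j y
    have hinv : (c y • (1 : Matrix (Fin 2) (Fin 2) ℝ))⁻¹ = (c y)⁻¹ • 1 := by
      apply Matrix.inv_eq_left_inv
      simp [smul_smul, (hc y).ne']
    have hlog (i) : partialD i (fun z ↦ Real.log (c z) / 2) y = partialD i c y / (2 * c y) := by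
      have := ((hd y).hasFDerivAt.log (hc y).ne').mul_const 2⁻¹
      simp only [partialD, div_eq_mul_inv]
      rw [this.fderiv]
      simp
      field_simp
    have hdelta (i j l : Fin 2) :
        partialD i (fun z ↦ (c z • (1 : Matrix (Fin 2) (Fin 2) ℝ)) j l) y =
          if j = l then partialD i c y else 0 := by
      simp only [Matrix.smul_apply, Matrix.one_apply, smul_eq_mul, partialD]
      split_ifs <;> simp
    simp only [christoffel, hinv, hdelta, hlog]
    have := (hc y).ne'
    fin_cases k <;> fin_cases i <;> fin_cases j <;> simp <;> field_simp
  have hneg (i : Fin 2) (f : Plane → ℝ) : partialD i (fun z ↦ -f z) y = -partialD i f y := by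
    simp [partialD, fderiv_fun_neg]
  have hdet : (c y • (1 : Matrix (Fin 2) (Fin 2) ℝ)).det = c y ^ 2 := by
    simp
  simp only [coordGaussCurvature, riemannCoeff, hch, hdet, flatLaplacian]
  simp [hneg]
  field_simp [(hc y).ne']
  ring

/-- The height `x₃` in the stereographic chart centred at `p`. -/
def chartHeight (p : S2) (y : Plane) : ℝ := (((extChartAt (𝓡 2) p).symm y : S2) : Space) 2

/-- `ℓ` is the third coordinate of the isometry of the coordinate plane onto `p^⊥`, so that `|ℓ|²`
is the squared length of the tangential part of the third basis vector. -/
theorem exists_hasFDerivAt_chartHeight (p : S2) : ∃ ℓ : Plane →L[ℝ] ℝ,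
    (∑ i, ℓ (EuclideanSpace.single i 1) ^ 2 = 1 - (p : Space) 2 ^ 2) ∧
    ∀ y, HasFDerivAt (chartHeight p) ((‖y‖ ^ 2 + 4)⁻¹ • ((4 : ℝ) • ℓ
      - (2 * ((p : Space) 2 + chartHeight p y)) • innerSL ℝ y)) y := by
  obtain ⟨J, hJp, hJ⟩ := exists_chart_symm_eq p
  refine ⟨(EuclideanSpace.proj 2).comp J.toContinuousLinearMap, ?_, fun y ↦ ?_⟩
  · have hpp : inner ℝ (p : Space) (p : Space) = (1 : ℝ) := by simp
    have hpJ (z) : inner ℝ (p : Space) (J z) = 0 := by rw [real_inner_comm]; exact hJp z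
    have hon : Orthonormal ℝ
        ![J (EuclideanSpace.single 0 1), J (EuclideanSpace.single 1 1), (p : Space)] := by
      rw [orthonormal_iff_ite]
      intro i j
      fin_cases i <;> fin_cases j <;>
        simp [hJp, hpJ, J.inner_map_map, EuclideanSpace.inner_single_left]
    have hspan := hon.linearIndependent.span_eq_top_of_card_eq_finrank' (by simp)
    have h := (OrthonormalBasis.mk hon hspan.ge).sum_sq_inner_right
      (EuclideanSpace.single (2 : Fin 3) (1 : ℝ))
    simp [Fin.sum_univ_three, EuclideanSpace.inner_single_right] at h
    simp
    linarith
  · have hD : ‖y‖ ^ 2 + 4 ≠ 0 := by positivity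
    have hn : HasFDerivAt (fun z : Plane ↦ ‖z‖ ^ 2) (2 • innerSL ℝ y) y :=
      (hasStrictFDerivAt_norm_sq y).hasFDerivAt
    have hN := (((((EuclideanSpace.proj (2 : Fin 3)).comp J.toContinuousLinearMap).hasFDerivAt
      (x := y))).const_mul (4 : ℝ)).add ((hn.const_sub 4).mul_const ((p : Space) 2))
    have hF := ((hasDerivAt_inv hD).comp_hasFDerivAt y (hn.add_const 4)).mul hN
    have e : chartHeight p = fun y ↦
      (‖y‖ ^ 2 + 4)⁻¹ * (4 * J y 2 + (4 - ‖y‖ ^ 2) * (p : Space) 2) := by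
      funext y
      rw [chartHeight, hJ]
      simp
      ring
    rw [e]
    refine HasFDerivAt.congr_fderiv hF ?_
    ext v
    simp
    field_simp
    ring

theorem chartHeight_zero (p : S2) : chartHeight p 0 = (p : Space) 2 := by
  rw [chartHeight, chart_symm_zero]

theorem contDiff_chartHeight (p : S2) : ContDiff ℝ ∞ (chartHeight p) := by
  have h := ((contMDiff_coe_sphere (n := 2) (m := ∞)).comp (contMDiff_chart_symm p)).contDiff
  exact (EuclideanSpace.proj (𝕜 := ℝ) (2 : Fin 3)).contDiff.comp h

theorem laplacian_conformalMetric {φ : S2 → ℝ} (hφ : ContMDiff (𝓡 2) 𝓘(ℝ, ℝ) ∞ φ)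
    (hpos : ∀ p, 0 < φ p) (u : S2 → ℝ) (p : S2) :
    laplacian (conformalMetric φ hφ hpos) u p =
      (φ p)⁻¹ * flatLaplacian (fun y ↦ u ((extChartAt (𝓡 2) p).symm y)) 0 := by
  rw [laplacian, extChartAt_self, funext (gram_conformalMetric hφ hpos p), coordLaplacian_smul_one]
  · rw [chart_symm_zero]
    norm_num
  · intro y
    have := hpos ((extChartAt (𝓡 2) p).symm y)
    positivity

theorem differentiableAt_deriv_of_contDiffAt {U : ℝ → ℝ} {x : ℝ} (hU : ContDiffAt ℝ 2 U x) :
    DifferentiableAt ℝ (deriv U) x := by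
  have h : ContDiffAt ℝ 1 (fderiv ℝ U) x := hU.fderiv_right (by norm_num)
  exact (h.differentiableAt (by simp)).clm_apply (differentiableAt_const (1 : ℝ))

theorem differentiableAt_partialD {F : Plane → ℝ} {y : Plane} (hF : ContDiffAt ℝ 2 F y)
    (i : Fin 2) : DifferentiableAt ℝ (partialD i F) y := by
  have h : ContDiffAt ℝ 1 (fderiv ℝ F) y := hF.fderiv_right (by norm_num)
  exact (h.differentiableAt (by simp)).clm_apply (differentiableAt_const _)

theorem flatLaplacian_add {F G : Plane → ℝ} {y : Plane} (hF : ContDiffAt ℝ 2 F y)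
    (hG : ContDiffAt ℝ 2 G y) :
    flatLaplacian (fun z ↦ F z + G z) y = flatLaplacian F y + flatLaplacian G y := by
  rw [flatLaplacian, flatLaplacian, flatLaplacian, ← Finset.sum_add_distrib]
  refine Finset.sum_congr rfl fun i _ ↦ ?_
  have e : partialD i (fun z ↦ F z + G z) =ᶠ[nhds y] fun z ↦ partialD i F z + partialD i G z := by
    filter_upwards [hF.eventually (by simp), hG.eventually (by simp)] with z hz hz'
    simp only [partialD]
    rw [fderiv_fun_add (hz.differentiableAt (by simp)) (hz'.differentiableAt (by simp))]
    rfl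
  rw [partialD, e.fderiv_eq, fderiv_fun_add (differentiableAt_partialD hF i)
    (differentiableAt_partialD hG i)]
  rfl

theorem flatLaplacian_const_sub_log (a : ℝ) :
    flatLaplacian (fun y : Plane ↦ a - Real.log (‖y‖ ^ 2 + 4)) 0 = -1 := by
  have hn (y : Plane) : HasFDerivAt (fun z : Plane ↦ ‖z‖ ^ 2) (2 • innerSL ℝ y) y :=
    (hasStrictFDerivAt_norm_sq y).hasFDerivAt
  have hne (y : Plane) : ‖y‖ ^ 2 + 4 ≠ 0 := by positivity
  have e (i : Fin 2) : partialD i (fun y : Plane ↦ a - Real.log (‖y‖ ^ 2 + 4)) =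
      fun y ↦ (‖y‖ ^ 2 + 4)⁻¹ * (-2 * y i) := by
    funext y
    have := (((hn y).add_const 4).log (hne y)).const_sub a
    rw [partialD]
    refine (DFunLike.congr_fun this.fderiv _).trans ?_
    simp [EuclideanSpace.inner_single_right]
  have hi (i : Fin 2) : partialD i (fun y : Plane ↦ (‖y‖ ^ 2 + 4)⁻¹ * (-2 * y i)) 0 = -(1 / 2) := by
    have h1 := (hasDerivAt_inv (hne 0)).comp_hasFDerivAt (0 : Plane) ((hn 0).add_const 4)
    have h2 := ((EuclideanSpace.proj (𝕜 := ℝ) i).hasFDerivAt (x := (0 : Plane))).const_mul (-2)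
    rw [partialD]
    refine (DFunLike.congr_fun (h1.mul h2).fderiv _).trans ?_
    simp
    norm_num
  simp only [flatLaplacian, e, hi]
  norm_num

/-- On zonal functions the round Laplacian is the Legendre operator `((1 - x²) U')'`. The chart
centred at `p` is isometric at `p`, so the flat Laplacian may be used there. -/
theorem flatLaplacian_comp_chartHeight (p : S2) {U : ℝ → ℝ}
    (hU : ContDiffAt ℝ 2 U ((p : Space) 2)) :
    flatLaplacian (fun y ↦ U (chartHeight p y)) 0 =
      (1 - (p : Space) 2 ^ 2) * deriv (deriv U) ((p : Space) 2)
        - 2 * (p : Space) 2 * deriv U ((p : Space) 2) := by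
  obtain ⟨ℓ, hℓ, hh⟩ := exists_hasFDerivAt_chartHeight p
  set x := (p : Space) 2 with hx
  have h0 : chartHeight p 0 = x := chartHeight_zero p
  have hcont : Continuous (chartHeight p) := (contDiff_chartHeight p).continuous
  have hUd : ∀ᶠ t in nhds x, DifferentiableAt ℝ U t :=
    (hU.eventually (by simp)).mono fun t ht ↦ ht.differentiableAt (by simp)
  have hUd' : ∀ᶠ y in nhds (0 : Plane), DifferentiableAt ℝ U (chartHeight p y) :=
    hcont.continuousAt.eventually (by rwa [h0])
  have hU2 : HasDerivAt (deriv U) (deriv (deriv U) x) (chartHeight p 0) := by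
    rw [h0]
    exact (differentiableAt_deriv_of_contDiffAt hU).hasDerivAt
  have hi (i : Fin 2) : partialD i (partialD i fun y ↦ U (chartHeight p y)) 0 =
      deriv (deriv U) x * ℓ (EuclideanSpace.single i 1) ^ 2 - x * deriv U x := by
    have e : partialD i (fun y ↦ U (chartHeight p y)) =ᶠ[nhds 0] fun y ↦
        deriv U (chartHeight p y) * ((‖y‖ ^ 2 + 4)⁻¹ * (4 * ℓ (EuclideanSpace.single i 1)
          - 2 * (x + chartHeight p y) * y i)) := by
      filter_upwards [hUd'] with y hy
      have := hy.hasDerivAt.comp_hasFDerivAt y (hh y)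
      rw [partialD]
      refine (DFunLike.congr_fun this.fderiv _).trans ?_
      simp [EuclideanSpace.inner_single_right]
    rw [partialD, e.fderiv_eq]
    have hn : HasFDerivAt (fun z : Plane ↦ ‖z‖ ^ 2) (2 • innerSL ℝ (0 : Plane)) 0 :=
      (hasStrictFDerivAt_norm_sq (0 : Plane)).hasFDerivAt
    have h1 := (hasDerivAt_inv (x := ‖(0 : Plane)‖ ^ 2 + 4) (by simp)).comp_hasFDerivAt (0 : Plane)
      (hn.add_const 4)
    have h2 := ((((hh 0).const_add x).const_mul 2).mul
      ((EuclideanSpace.proj (𝕜 := ℝ) i).hasFDerivAt (x := (0 : Plane)))).const_sub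
        (4 * ℓ (EuclideanSpace.single i 1))
    have h3 := (hU2.comp_hasFDerivAt (0 : Plane) (hh 0)).mul (h1.mul h2)
    refine (DFunLike.congr_fun h3.fderiv _).trans ?_
    simp [h0]
    ring
  rw [flatLaplacian]
  simp only [hi, Finset.sum_sub_distrib, ← Finset.mul_sum, hℓ]
  simp
  ring

/-- `K = (1 - ½ Δ_round (log f)) / f` for the metric `f(x₃) g_round`. -/
theorem gaussCurvature_conformalMetric {φ : S2 → ℝ} (hφ : ContMDiff (𝓡 2) 𝓘(ℝ, ℝ) ∞ φ)
    (hpos : ∀ p, 0 < φ p) {f : ℝ → ℝ} (hf : ∀ p, φ p = f ((p : Space) 2)) (p : S2)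
    (hfp : ContDiffAt ℝ 2 f ((p : Space) 2)) :
    gaussCurvature (conformalMetric φ hφ hpos) p = (φ p)⁻¹ *
      (1 - ((1 - (p : Space) 2 ^ 2) * deriv (deriv fun t ↦ Real.log (f t)) ((p : Space) 2)
        - 2 * (p : Space) 2 * deriv (fun t ↦ Real.log (f t)) ((p : Space) 2)) / 2) := by
  have hc : ∀ y, 0 < φ ((extChartAt (𝓡 2) p).symm y) * (16 / (‖y‖ ^ 2 + 4) ^ 2) := by
    intro y
    have := hpos ((extChartAt (𝓡 2) p).symm y)
    positivity
  have hd : ContDiff ℝ ∞ fun y : Plane ↦ φ ((extChartAt (𝓡 2) p).symm y) := 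
    (hφ.comp (contMDiff_chart_symm p)).contDiff
  have hd2 : ContDiff ℝ ∞ fun y : Plane ↦ ‖y‖ ^ 2 + 4 := (contDiff_norm_sq ℝ).add contDiff_const
  have hne (y : Plane) : ‖y‖ ^ 2 + 4 ≠ 0 := by positivity
  rw [gaussCurvature, extChartAt_self, funext (gram_conformalMetric hφ hpos p),
    coordGaussCurvature_smul_one hc (by
      refine ((hd.mul (contDiff_const.div (hd2.pow 2) fun y ↦
        pow_ne_zero 2 (hne y)))).differentiable (by simp))]
  have hlog : (fun z ↦ Real.log (φ ((extChartAt (𝓡 2) p).symm z) * (16 / (‖z‖ ^ 2 + 4) ^ 2)) / 2) =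
      fun y ↦ (fun y ↦ Real.log (f (chartHeight p y)) / 2) y + (fun y : Plane ↦
        Real.log 16 / 2 - Real.log (‖y‖ ^ 2 + 4)) y := by
    funext y
    simp only []
    rw [Real.log_mul (hpos _).ne' (div_ne_zero (by norm_num) (pow_ne_zero 2 (hne y))),
      Real.log_div (by norm_num) (pow_ne_zero 2 (hne y)), Real.log_pow, hf]
    simp only [chartHeight]
    push_cast
    ring
  have hfpos : 0 < f ((p : Space) 2) := hf p ▸ hpos p
  have hL : ContDiffAt ℝ 2 (fun t ↦ Real.log (f t) / 2) ((p : Space) 2) :=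
    (hfp.log hfpos.ne').div_const 2
  have hF : ContDiffAt ℝ 2 (fun y ↦ Real.log (f (chartHeight p y)) / 2) 0 := by
    rw [← chartHeight_zero p] at hL
    exact hL.comp 0 ((contDiff_chartHeight p).of_le ENat.LEInfty.out).contDiffAt
  have hG : ContDiffAt ℝ 2 (fun y : Plane ↦ Real.log 16 / 2 - Real.log (‖y‖ ^ 2 + 4)) 0 :=
    contDiffAt_const.sub (((hd2.of_le ENat.LEInfty.out).contDiffAt).log (hne 0))
  rw [hlog, flatLaplacian_add hF hG, flatLaplacian_const_sub_log,
    flatLaplacian_comp_chartHeight p hL, chart_symm_zero]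
  have e1 : deriv (fun t ↦ Real.log (f t) / 2) = fun x ↦ deriv (fun t ↦ Real.log (f t)) x / 2 := by
    funext x
    exact deriv_div_const 2
  rw [e1, deriv_div_const]
  norm_num
  ring

/-! ### The maximum principle -/

theorem flatLaplacian_nonpos_of_isLocalMax {F : Plane → ℝ} {y : Plane} (hF : ContDiff ℝ 2 F)
    (hmax : IsLocalMax F y) : flatLaplacian F y ≤ 0 := by
  refine Finset.sum_nonpos fun i _ ↦ ?_
  set e : Plane := EuclideanSpace.single i 1
  set g : ℝ → ℝ := fun t ↦ F (y + t • e)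
  have hline (t : ℝ) : HasDerivAt (fun t : ℝ ↦ y + t • e) e t := by
    simpa using ((hasDerivAt_id t).smul_const e).const_add y
  have h0 : y + (0 : ℝ) • e = y := by simp
  have hg1 : deriv g = fun t ↦ partialD i F (y + t • e) := by
    funext t
    exact ((hF.differentiable (by simp) _).hasFDerivAt.comp_hasDerivAt t (hline t)).deriv
  have hg2 : deriv (deriv g) 0 = partialD i (partialD i F) y := by
    rw [hg1]
    have := ((differentiableAt_partialD hF.contDiffAt i).hasFDerivAt
      (x := y + (0 : ℝ) • e)).comp_hasDerivAt (0 : ℝ) (hline 0)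
    rw [h0] at this
    exact this.deriv
  have hgmax : IsLocalMax g 0 := by
    have hc : Filter.Tendsto (fun t : ℝ ↦ y + t • e) (nhds 0) (nhds y) := by
      simpa [h0] using (hline 0).continuousAt.tendsto
    have := hc.eventually hmax
    filter_upwards [this] with t ht
    simpa [g] using ht
  rw [← hg2]
  by_contra! hpos
  have hgc : ContinuousAt g 0 := by
    have : Continuous g := hF.continuous.comp (by fun_prop)
    exact this.continuousAt
  have hmin := isLocalMin_of_deriv_deriv_pos hpos hgmax.deriv_eq_zero hgc
  -- a point which is both a local maximum and a local minimum: `g` is locally constant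
  have hconst : g =ᶠ[nhds 0] fun _ ↦ g 0 := by
    filter_upwards [hmin, hgmax] with t h1 h2
    exact le_antisymm h2 h1
  have : deriv (deriv g) 0 = 0 := by
    rw [hconst.deriv.deriv_eq]
    simp
  linarith

theorem laplacian_nonpos_of_forall_le {φ : S2 → ℝ} (hφ : ContMDiff (𝓡 2) 𝓘(ℝ, ℝ) ∞ φ)
    (hpos : ∀ p, 0 < φ p) {u : S2 → ℝ} (hu : ContMDiff (𝓡 2) 𝓘(ℝ, ℝ) ∞ u) {p : S2}
    (hmax : ∀ q, u q ≤ u p) : laplacian (conformalMetric φ hφ hpos) u p ≤ 0 := by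
  rw [laplacian_conformalMetric]
  refine mul_nonpos_of_nonneg_of_nonpos (inv_nonneg.2 (hpos p).le)
    (flatLaplacian_nonpos_of_isLocalMax ?_ ?_)
  · exact ((hu.comp (contMDiff_chart_symm p)).contDiff).of_le ENat.LEInfty.out
  · refine Filter.Eventually.of_forall fun y ↦ ?_
    simpa only [chart_symm_zero] using hmax _

theorem laplacian_neg {φ : S2 → ℝ} (hφ : ContMDiff (𝓡 2) 𝓘(ℝ, ℝ) ∞ φ)
    (hpos : ∀ p, 0 < φ p) (u : S2 → ℝ) (p : S2) :
    laplacian (conformalMetric φ hφ hpos) (fun q ↦ -u q) p =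
      -laplacian (conformalMetric φ hφ hpos) u p := by
  have hneg (i : Fin 2) (f : Plane → ℝ) :
      partialD i (fun z ↦ -f z) = fun y ↦ -partialD i f y := by
    funext y
    simp [partialD, fderiv_fun_neg]
  simp only [laplacian_conformalMetric, flatLaplacian, hneg, Finset.sum_neg_distrib, mul_neg]

/-- If `K ≥ 0` and `α ≥ 0`, then `-Δ + α K` has no negative eigenvalue. By the maximum principle, an
eigenfunction for a negative eigenvalue can have neither a positive maximum nor a negative
minimum. -/
theorem nonneg_of_solvesEigenEquation {φ : S2 → ℝ} {hφ : ContMDiff (𝓡 2) 𝓘(ℝ, ℝ) ∞ φ}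
    {hpos : ∀ p, 0 < φ p} (hK : ∀ p, 0 ≤ gaussCurvature (conformalMetric φ hφ hpos) p)
    {α μ : ℝ} (hα : 0 ≤ α) {u : S2 → ℝ}
    (hu : SolvesEigenEquation (conformalMetric φ hφ hpos) α μ u) (hne : u ≠ 0) : 0 ≤ μ := by
  by_contra! hμ
  have key : ∀ v : S2 → ℝ, SolvesEigenEquation (conformalMetric φ hφ hpos) α μ v →
      ∀ q, v q ≤ 0 := by
    intro v hv q
    obtain ⟨p, -, hp⟩ := isCompact_univ.exists_isMaxOn ⟨q, trivial⟩ hv.1.continuous.continuousOn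
    have hmax : ∀ q, v q ≤ v p := fun q ↦ hp trivial
    refine (hmax q).trans ?_
    by_contra! hvp
    have h1 := laplacian_nonpos_of_forall_le hφ hpos hv.1 hmax
    have h2 := hv.2 p
    have h3 := mul_nonneg (mul_nonneg hα (hK p)) hvp.le
    have h4 := mul_neg_of_neg_of_pos hμ hvp
    linarith
  refine hne (funext fun q ↦ le_antisymm (key u hu q) ?_)
  have hneg : SolvesEigenEquation (conformalMetric φ hφ hpos) α μ (fun q ↦ -u q) := by
    refine ⟨hu.1.neg, fun p ↦ ?_⟩
    rw [laplacian_neg]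
    linarith [hu.2 p]
  simpa using key _ hneg q

end Geometry

section SturmLiouville

open MeasureTheory Set

/-! ### Averages over segments -/

/-- A smooth function on a neighbourhood of `[a, b]` agrees near `[a, b]` with a bounded smooth
function on the line: multiply it by a bump function. -/
theorem exists_contDiff_bounded_eqOn {g : ℝ → ℝ} {a b δ : ℝ} (hab : a ≤ b) (hδ : 0 < δ)
    (hg : ContDiffOn ℝ ∞ g (Ioo (a - δ) (b + δ))) :
    ∃ G : ℝ → ℝ, ContDiff ℝ ∞ G ∧ (∃ B, ∀ x, |G x| ≤ B) ∧
      EqOn G g (Ioo (a - δ / 3) (b + δ / 3)) := by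
  let ρ : ContDiffBump ((a + b) / 2) :=
    { rIn := (b - a) / 2 + δ / 3, rOut := (b - a) / 2 + 2 * δ / 3, rIn_pos := by linarith,
      rIn_lt_rOut := by linarith }
  have hcont : ContDiff ℝ ∞ (fun x ↦ ρ x * g x) := by
    rw [contDiff_iff_contDiffAt]
    intro x
    by_cases hx : x ∈ Ioo (a - δ) (b + δ)
    · exact ρ.contDiff.contDiffAt.mul (hg.contDiffAt (isOpen_Ioo.mem_nhds hx))
    · have hx' : x ∉ tsupport ρ := by
        rw [ρ.tsupport_eq, Real.closedBall_eq_Icc]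
        intro h
        change x ∈ Icc ((a + b) / 2 - ((b - a) / 2 + 2 * δ / 3))
          ((a + b) / 2 + ((b - a) / 2 + 2 * δ / 3)) at h
        exact hx ⟨by linarith [h.1], by linarith [h.2]⟩
      have : (fun x ↦ ρ x * g x) =ᶠ[nhds x] fun _ ↦ 0 := by
        filter_upwards [notMem_tsupport_iff_eventuallyEq.1 hx'] with y hy
        simp [hy]
      exact contDiffAt_const.congr_of_eventuallyEq this
  have hsupp : HasCompactSupport (fun x ↦ ρ x * g x) := ρ.hasCompactSupport.mul_right
  obtain ⟨B, hB⟩ := hsupp.exists_bound_of_continuous hcont.continuous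
  refine ⟨_, hcont, ⟨B, hB⟩, fun x hx ↦ ?_⟩
  have : ρ x = 1 := ρ.one_of_mem_closedBall (by
    rw [Real.closedBall_eq_Icc]
    change x ∈ Icc ((a + b) / 2 - ((b - a) / 2 + δ / 3)) ((a + b) / 2 + ((b - a) / 2 + δ / 3))
    exact ⟨by linarith [hx.1], by linarith [hx.2]⟩)
  simp [this]

/-- The average `∫₀¹ h(τ z) dτ` of `h` over the segment from `0` to `z`. -/
def segmentAverage (h : ℝ → ℝ) (z : ℝ) : ℝ := ∫ τ in (0 : ℝ)..1, h (τ * z)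

theorem hasDerivAt_weighted_segmentAverage {h : ℝ → ℝ} (hh : ContDiff ℝ 1 h) (j : ℕ) (z : ℝ) :
    HasDerivAt (fun z ↦ ∫ τ in (0 : ℝ)..1, τ ^ j * h (τ * z))
      (∫ τ in (0 : ℝ)..1, τ ^ (j + 1) * deriv h (τ * z)) z := by
  have hc : Continuous h := hh.continuous
  have hc' : Continuous (deriv h) := hh.continuous_deriv (by simp)
  obtain ⟨B, hB⟩ := (isCompact_Icc (a := -(|z| + 1)) (b := |z| + 1)).exists_bound_of_continuousOn
    hc'.continuousOn
  refine (intervalIntegral.hasDerivAt_integral_of_dominated_loc_of_deriv_le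
    (F := fun z τ ↦ τ ^ j * h (τ * z)) (F' := fun z τ ↦ τ ^ (j + 1) * deriv h (τ * z))
    (bound := fun _ ↦ B) (Metric.ball_mem_nhds z one_pos) ?_ ?_ ?_ ?_ ?_ ?_).2
  · exact Filter.Eventually.of_forall fun x ↦
      (show Continuous fun τ ↦ τ ^ j * h (τ * x) by fun_prop).aestronglyMeasurable
  · exact (show Continuous fun τ ↦ τ ^ j * h (τ * z) by fun_prop).intervalIntegrable _ _
  · exact (show Continuous fun τ ↦ τ ^ (j + 1) * deriv h (τ * z) by fun_prop).aestronglyMeasurable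
  · refine Filter.Eventually.of_forall fun τ hτ x hx ↦ ?_
    rw [uIoc_of_le zero_le_one] at hτ
    have hx1 : |x| ≤ |z| + 1 := by
      have h1 : |x - z| < 1 := by simpa [Real.dist_eq] using hx
      have h2 := abs_add_le (x - z) z
      rw [sub_add_cancel] at h2
      linarith
    have h1 : |τ * x| ≤ |z| + 1 := by
      rw [abs_mul, abs_of_pos hτ.1]
      nlinarith [abs_nonneg x, hτ.1, hτ.2]
    have h2 : ‖deriv h (τ * x)‖ ≤ B := hB _ (abs_le.1 h1)
    rw [norm_mul, Real.norm_eq_abs, abs_of_nonneg (pow_nonneg hτ.1.le _)]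
    calc τ ^ (j + 1) * ‖deriv h (τ * x)‖ ≤ 1 * ‖deriv h (τ * x)‖ := by
          gcongr
          exact pow_le_one₀ hτ.1.le hτ.2
      _ ≤ B := by linarith
  · exact intervalIntegrable_const
  · refine Filter.Eventually.of_forall fun τ _ x _ ↦ ?_
    have h1 := ((hh.differentiable (by simp) (τ * x)).hasDerivAt.comp x
      ((hasDerivAt_id x).const_mul τ)).const_mul (τ ^ j)
    refine h1.congr_deriv ?_
    simp
    ring

/-- The weights `τ ^ j` are there for the induction on `n`: each derivative raises `j` by one. -/
theorem contDiff_weighted_segmentAverage (n : ℕ) : ∀ {h : ℝ → ℝ} (_ : ContDiff ℝ n h) (j : ℕ),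
    ContDiff ℝ n fun z ↦ ∫ τ in (0 : ℝ)..1, τ ^ j * h (τ * z) := by
  induction n with
  | zero =>
    intro h hh j
    have hc := hh.continuous
    refine contDiff_zero.2 (intervalIntegral.continuous_parametric_intervalIntegral_of_continuous'
      ?_ _ _)
    fun_prop
  | succ n ih =>
    intro h hh j
    have h1 : ContDiff ℝ 1 h := hh.of_le (by norm_cast; omega)
    push_cast at hh ⊢
    rw [contDiff_succ_iff_deriv] at hh ⊢
    have hd := hasDerivAt_weighted_segmentAverage h1 j
    refine ⟨fun z ↦ (hd z).differentiableAt, by simp, ?_⟩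
    rw [funext fun z ↦ (hd z).deriv]
    exact ih hh.2.2 (j + 1)

theorem contDiff_segmentAverage {n : ℕ} {h : ℝ → ℝ} (hh : ContDiff ℝ n h) :
    ContDiff ℝ n (segmentAverage h) := by
  have := contDiff_weighted_segmentAverage n hh 0
  simp only [pow_zero, one_mul] at this
  exact this

theorem mul_segmentAverage (h : ℝ → ℝ) (z : ℝ) : z * segmentAverage h z = ∫ s in (0 : ℝ)..z,
    h s := by
  have := intervalIntegral.mul_integral_comp_mul_right (a := 0) (b := 1) (f := h) z
  rw [zero_mul, one_mul] at this
  exact this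

theorem abs_segmentAverage_le {h : ℝ → ℝ} {C l : ℝ} (hl : 0 ≤ l) (hC : 0 ≤ C)
    (hb : ∀ s, |h s| ≤ C * Real.exp (l * |s|)) (z : ℝ) :
    |segmentAverage h z| ≤ C * Real.exp (l * |z|) := by
  have := intervalIntegral.norm_integral_le_of_norm_le_const (a := (0 : ℝ)) (b := 1)
    (f := fun τ ↦ h (τ * z)) (C := C * Real.exp (l * |z|)) ?_
  · rw [sub_zero, abs_one, mul_one] at this
    exact this
  · intro τ hτ
    rw [uIoc_of_le zero_le_one] at hτ
    refine (hb _).trans ?_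
    have h1 : |τ * z| ≤ |z| := by
      rw [abs_mul, abs_of_pos hτ.1]
      nlinarith [abs_nonneg z, hτ.2]
    gcongr

/-- Integration from `0` gains a factor `1 / l` in the norm with weight `e^{l |z|}`. -/
theorem abs_integral_le_exp {h : ℝ → ℝ} {C l : ℝ} (hl : 0 < l) (hC : 0 ≤ C)
    (hb : ∀ s, |h s| ≤ C * Real.exp (l * |s|)) (z : ℝ) :
    |∫ s in (0 : ℝ)..z, h s| ≤ C / l * Real.exp (l * |z|) := by
  rw [← mul_segmentAverage, abs_mul]
  have h1 : |segmentAverage h z| ≤ ∫ τ in (0 : ℝ)..1, C * Real.exp (l * |z| * τ) := by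
    refine intervalIntegral.norm_integral_le_of_norm_le (f := fun τ ↦ h (τ * z)) zero_le_one ?_ ?_
    · refine Filter.Eventually.of_forall fun τ hτ ↦ (hb _).trans (le_of_eq ?_)
      rw [abs_mul, abs_of_pos hτ.1]
      ring_nf
    · exact (show Continuous fun τ ↦ C * Real.exp (l * |z| * τ) by fun_prop).intervalIntegrable _ _
  have h2 : |z| * ∫ τ in (0 : ℝ)..1, C * Real.exp (l * |z| * τ) =
      C / l * Real.exp (l * |z| * 1) - C / l * Real.exp (l * |z| * 0) := by
    rw [← intervalIntegral.integral_const_mul]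
    refine intervalIntegral.integral_eq_sub_of_hasDerivAt
      (f := fun τ ↦ C / l * Real.exp (l * |z| * τ)) (fun τ _ ↦ ?_) ?_
    · have := (((hasDerivAt_id τ).const_mul (l * |z|)).exp).const_mul (C / l)
      refine this.congr_deriv ?_
      simp
      field_simp
    · exact (show Continuous fun τ ↦ |z| * (C * Real.exp (l * |z| * τ)) by
        fun_prop).intervalIntegrable _ _
  have h3 : 0 ≤ C / l := by positivity
  calc |z| * |segmentAverage h z| ≤ _ := mul_le_mul_of_nonneg_left h1 (abs_nonneg z)
    _ ≤ _ := by
      rw [h2]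
      simp
      exact h3

/-! ### A singular Volterra equation -/

theorem continuous_segmentAverage_param {X : Type*} [TopologicalSpace X] {h : X → ℝ → ℝ}
    (hh : Continuous (Function.uncurry h)) :
    Continuous fun x : X × ℝ ↦ segmentAverage (h x.1) x.2 :=
  intervalIntegral.continuous_parametric_intervalIntegral_of_continuous'
    (show Continuous fun y : (X × ℝ) × ℝ ↦ h y.1.1 (y.2 * y.1.2) from
      hh.comp (by fun_prop : Continuous fun y : (X × ℝ) × ℝ ↦ (y.1.1, y.2 * y.1.2))) _ _

theorem continuous_segmentAverage {h : ℝ → ℝ} (hh : Continuous h) :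
    Continuous (segmentAverage h) :=
  contDiff_zero.1 (contDiff_segmentAverage (n := 0) (contDiff_zero.2 hh))

theorem segmentAverage_sub {g h : ℝ → ℝ} (hg : Continuous g) (hh : Continuous h) (z : ℝ) :
    segmentAverage g z - segmentAverage h z = segmentAverage (fun s ↦ g s - h s) z :=
  (intervalIntegral.integral_sub
    ((show Continuous fun τ ↦ g (τ * z) by fun_prop).intervalIntegrable _ _)
    ((show Continuous fun τ ↦ h (τ * z) by fun_prop).intervalIntegrable _ _)).symm

/-- The Volterra operator `w ↦ ∫₀^z k(s) (∫₀¹ q(τ s) w(τ s) dτ) ds`. A fixed point of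
`1 + volterra k q` satisfies `z u' = k ∫₀^z q u` and `u(0) = 1`; for `k(z) = 1 / (2 - z)` this is
the equation `(z (2 - z) u')' = q u`, together with regularity at its singular point `0`. -/
def volterra (k q w : ℝ → ℝ) (z : ℝ) : ℝ :=
  ∫ s in (0 : ℝ)..z, k s * segmentAverage (fun r ↦ q r * w r) s

theorem volterra_sub {k q v w : ℝ → ℝ} (hk : Continuous k) (hq : Continuous q) (hv : Continuous v)
    (hw : Continuous w) (z : ℝ) :
    volterra k q v z - volterra k q w z = volterra k q (fun s ↦ v s - w s) z := by
  rw [volterra, volterra, ← intervalIntegral.integral_sub]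
  · refine intervalIntegral.integral_congr fun s _ ↦ ?_
    rw [← mul_sub, segmentAverage_sub (g := fun r ↦ q r * v r) (h := fun r ↦ q r * w r)
      (hq.mul hv) (hq.mul hw)]
    simp only [← mul_sub]
  · exact (hk.mul (continuous_segmentAverage (hq.mul hv))).intervalIntegrable _ _
  · exact (hk.mul (continuous_segmentAverage (hq.mul hw))).intervalIntegrable _ _

theorem abs_volterra_le {k q w : ℝ → ℝ} {A B C l : ℝ} (hA : ∀ z, |k z| ≤ A) (hB : ∀ z, |q z| ≤ B)
    (hC : 0 ≤ C) (hl : 0 < l) (hw : ∀ z, |w z| ≤ C * Real.exp (l * |z|)) (z : ℝ) :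
    |volterra k q w z| ≤ A * B * C / l * Real.exp (l * |z|) := by
  have hA0 : 0 ≤ A := (abs_nonneg _).trans (hA 0)
  have hB0 : 0 ≤ B := (abs_nonneg _).trans (hB 0)
  refine abs_integral_le_exp hl (by positivity) (fun s ↦ ?_) z
  have h1 := abs_segmentAverage_le (h := fun r ↦ q r * w r) (C := B * C) hl.le (by positivity)
    (fun r ↦ by
      rw [abs_mul, mul_assoc]
      exact mul_le_mul (hB r) (hw r) (abs_nonneg _) hB0) s
  rw [abs_mul, mul_assoc A, mul_assoc A]
  exact mul_le_mul (hA s) h1 (abs_nonneg _) hA0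

theorem continuous_volterra_param {X : Type*} [TopologicalSpace X] {k : ℝ → ℝ} {q w : X → ℝ → ℝ}
    (hk : Continuous k) (hq : Continuous (Function.uncurry q))
    (hw : Continuous (Function.uncurry w)) :
    Continuous fun x : X × ℝ ↦ volterra k (q x.1) (w x.1) x.2 := by
  refine intervalIntegral.continuous_parametric_intervalIntegral_of_continuous
    (f := fun (x : X × ℝ) s ↦ k s * segmentAverage (fun r ↦ q x.1 r * w x.1 r) s) ?_ continuous_snd
  have h1 : Continuous fun x : X × ℝ ↦ segmentAverage (fun r ↦ q x.1 r * w x.1 r) x.2 :=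
    continuous_segmentAverage_param (h := fun x r ↦ q x r * w x r) (hq.mul hw)
  have h2 : Continuous fun y : (X × ℝ) × ℝ ↦ (y.1.1, y.2) := by fun_prop
  exact (hk.comp continuous_snd).mul (h1.comp h2)

/-- Solutions that depend continuously on the parameter are found in one step, by Banach's fixed
point theorem for bounded continuous functions of parameter and point: the map is a contraction in
the norm with weight `e^{-l |z|}`, for large `l`. -/
theorem exists_volterra_solution {k : ℝ → ℝ} {q : ℝ → ℝ → ℝ} (hk : Continuous k)
    (hq : Continuous (Function.uncurry q)) {A B : ℝ} (hA : ∀ z, |k z| ≤ A)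
    (hB : ∀ μ z, |q μ z| ≤ B) :
    ∃ u : ℝ → ℝ → ℝ, Continuous (Function.uncurry u) ∧
      ∀ μ z, u μ z = 1 + volterra k (q μ) (u μ) z := by
  have hA0 : 0 ≤ A := (abs_nonneg _).trans (hA 0)
  have hB0 : 0 ≤ B := (abs_nonneg _).trans (hB 0 0)
  obtain ⟨l, hl, hl0⟩ : ∃ l, 2 * (A * B) ≤ l ∧ 0 < l :=
    ⟨2 * (A * B) + 1, by linarith, by positivity⟩
  have hABl : A * B / l ≤ 1 / 2 := by rw [div_le_iff₀ hl0]; linarith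
  let E : ℝ → ℝ := fun z ↦ Real.exp (l * |z|)
  have hE : Continuous E := by fun_prop
  have hEpos (z) : 0 < E z := Real.exp_pos _
  have hE1 (z) : 1 ≤ E z := Real.one_le_exp (by positivity)
  let W : BoundedContinuousFunction (ℝ × ℝ) ℝ → ℝ → ℝ → ℝ := fun v μ z ↦ E z * v (μ, z)
  have hWc (v) : Continuous (Function.uncurry (W v)) :=
    (hE.comp continuous_snd).mul (v.continuous.comp (by fun_prop))
  have hWc' (v μ) : Continuous (W v μ) := (hWc v).comp (by fun_prop : Continuous fun z ↦ (μ, z))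
  have hqc (μ) : Continuous (q μ) := hq.comp (by fun_prop : Continuous fun z ↦ (μ, z))
  have hest {C : ℝ} (hC : 0 ≤ C) {w : ℝ → ℝ} (μ) (hw : ∀ z, |w z| ≤ C * E z) (z) :
      |volterra k (q μ) w z| ≤ C / 2 * E z := by
    refine (abs_volterra_le hA (hB μ) hC hl0 hw z).trans ?_
    have : A * B * C / l ≤ C / 2 := by
      rw [mul_div_right_comm]
      nlinarith
    exact mul_le_mul_of_nonneg_right this (hEpos z).le
  have hWb (v : BoundedContinuousFunction (ℝ × ℝ) ℝ) (μ z) : |W v μ z| ≤ ‖v‖ * E z := by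
    simp only [W]
    rw [abs_mul, abs_of_pos (hEpos z), mul_comm]
    exact mul_le_mul_of_nonneg_right (v.norm_coe_le_norm _) (hEpos z).le
  let Φ : BoundedContinuousFunction (ℝ × ℝ) ℝ → BoundedContinuousFunction (ℝ × ℝ) ℝ := fun v ↦
    BoundedContinuousFunction.ofNormedAddCommGroup
      (fun x ↦ (E x.2)⁻¹ * (1 + volterra k (q x.1) (W v x.1) x.2))
      (((hE.comp continuous_snd).inv₀ fun x ↦ (hEpos _).ne').mul
        (continuous_const.add (continuous_volterra_param hk hq (hWc v))))
      (1 + ‖v‖ / 2) (fun x ↦ by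
        rw [norm_mul, norm_inv, Real.norm_of_nonneg (hEpos _).le, inv_mul_le_iff₀ (hEpos _)]
        refine (norm_add_le _ _).trans ?_
        have := hest (norm_nonneg v) x.1 (hWb v x.1) x.2
        rw [norm_one, Real.norm_eq_abs]
        nlinarith [hE1 x.2])
  have hΦ : ContractingWith (1 / 2) Φ := by
    refine ⟨by norm_num, LipschitzWith.of_dist_le_mul fun v w ↦ ?_⟩
    rw [BoundedContinuousFunction.dist_le (by positivity)]
    rintro ⟨μ, z⟩
    have e : Φ v (μ, z) - Φ w (μ, z) =
        (E z)⁻¹ * volterra k (q μ) (fun s ↦ W v μ s - W w μ s) z := by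
      rw [← volterra_sub hk (hqc μ) (hWc' v μ) (hWc' w μ)]
      change (E z)⁻¹ * (1 + volterra k (q μ) (W v μ) z) - (E z)⁻¹ *
        (1 + volterra k (q μ) (W w μ) z) = _
      ring
    rw [Real.dist_eq, e, abs_mul, abs_inv, abs_of_pos (hEpos z), inv_mul_le_iff₀ (hEpos z)]
    refine (hest (C := dist v w) dist_nonneg μ (fun s ↦ ?_) z).trans (le_of_eq ?_)
    · have : W v μ s - W w μ s = E s * (v (μ, s) - w (μ, s)) := by simp only [W]; ring
      rw [this, abs_mul, abs_of_pos (hEpos s), mul_comm]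
      exact mul_le_mul_of_nonneg_right (v.dist_coe_le_dist (g := w) _) (hEpos s).le
    · push_cast
      ring
  let v := ContractingWith.fixedPoint Φ hΦ
  have hv : Φ v = v := hΦ.fixedPoint_isFixedPt
  refine ⟨W v, hWc v, fun μ z ↦ ?_⟩
  have h1 : v (μ, z) = (E z)⁻¹ * (1 + volterra k (q μ) (W v μ) z) :=
    (DFunLike.congr_fun hv (μ, z)).symm
  change E z * v (μ, z) = _
  rw [h1, mul_inv_cancel_left₀ (hEpos z).ne']

theorem hasDerivAt_of_volterra {k q u : ℝ → ℝ} (hk : Continuous k) (hq : Continuous q)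
    (hu : Continuous u) (h : ∀ z, u z = 1 + volterra k q u z) (z : ℝ) :
    HasDerivAt u (k z * segmentAverage (fun r ↦ q r * u r) z) z := by
  have hc : Continuous fun s ↦ k s * segmentAverage (fun r ↦ q r * u r) s :=
    hk.mul (continuous_segmentAverage (hq.mul hu))
  exact ((hc.integral_hasStrictDerivAt 0 z).hasDerivAt.const_add 1).congr_of_eventuallyEq
    (Filter.Eventually.of_forall h)

/-- If `u` is `C^n`, then so is `u' = k · segmentAverage (q u)`. -/
theorem contDiff_of_volterra {k q u : ℝ → ℝ} (hk : ContDiff ℝ ∞ k) (hq : ContDiff ℝ ∞ q)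
    (hu : Continuous u) (h : ∀ z, u z = 1 + volterra k q u z) : ContDiff ℝ ∞ u := by
  have hd := hasDerivAt_of_volterra hk.continuous hq.continuous hu h
  rw [contDiff_infty]
  intro n
  induction n with
  | zero => exact contDiff_zero.2 hu
  | succ n ih =>
    push_cast
    rw [contDiff_succ_iff_deriv]
    refine ⟨fun z ↦ (hd z).differentiableAt, by simp, ?_⟩
    rw [funext fun z ↦ (hd z).deriv]
    exact (contDiff_infty.1 hk n).mul (contDiff_segmentAverage ((contDiff_infty.1 hq n).mul ih))

/-! ### Regular solutions of Legendre-type equations -/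

/-- The solutions `U μ` of `((1 - x²) U')' = (q - μ f) U` that are regular at the pole `x = 1` and
normalized there, with their derivatives `V μ`. They depend continuously on `μ` and extend beyond
the equator `x = 0`. -/
theorem exists_regular_solutions {q f : ℝ → ℝ} {δ M : ℝ} (hδ : 0 < δ) (hM : 0 ≤ M)
    (hq : ContDiffOn ℝ ∞ q (Ioo (-1 - δ) (1 + δ))) (hf : ContDiffOn ℝ ∞ f (Ioo (-1 - δ) (1 + δ))) :
    ∃ U V : ℝ → ℝ → ℝ, Continuous (Function.uncurry U) ∧ Continuous (Function.uncurry V) ∧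
      ∃ ε > 0, ∀ μ ∈ Icc 0 M, ContDiff ℝ ∞ (U μ) ∧ U μ 1 = 1 ∧ (∀ x, HasDerivAt (U μ) (V μ x) x) ∧
        ∀ x ∈ Ioo (-1 / 2) (1 + ε), HasDerivAt (fun x ↦ (1 - x ^ 2) * V μ x)
          ((q x - μ * f x) * U μ x) x := by
  set η := min δ (1 / 4) with hη
  have hη0 : 0 < η := lt_min hδ (by norm_num)
  have hηδ : η ≤ δ := min_le_left _ _
  have hη4 : η ≤ 1 / 4 := min_le_right _ _
  have hmap : MapsTo (fun z : ℝ ↦ 1 - z) (Ioo (0 - η) (3 / 2 + η)) (Ioo (-1 - δ) (1 + δ)) := by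
    intro z hz
    exact ⟨by linarith [hz.2], by linarith [hz.1]⟩
  have hlin : ContDiffOn ℝ ∞ (fun z : ℝ ↦ 1 - z) (Ioo (0 - η) (3 / 2 + η)) :=
    (contDiff_const.sub contDiff_id).contDiffOn
  obtain ⟨Q, hQ, ⟨BQ, hBQ⟩, hQe⟩ := exists_contDiff_bounded_eqOn (g := fun z ↦ q (1 - z))
    (a := 0) (b := 3 / 2) (by norm_num) hη0 (hq.comp hlin hmap)
  obtain ⟨F, hF, ⟨BF, hBF⟩, hFe⟩ := exists_contDiff_bounded_eqOn (g := fun z ↦ f (1 - z))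
    (a := 0) (b := 3 / 2) (by norm_num) hη0 (hf.comp hlin hmap)
  obtain ⟨k, hk, ⟨A, hA⟩, hke⟩ := exists_contDiff_bounded_eqOn (g := fun z : ℝ ↦ (2 - z)⁻¹)
    (a := 0) (b := 3 / 2) (by norm_num) hη0 (by
      refine (contDiff_const.sub contDiff_id).contDiffOn.inv fun z hz ↦ ?_
      have := hz.2
      change (2 - z) ≠ 0
      linarith)
  -- the parameter is clamped to `[0, M]` so that the coefficient is bounded on all of `ℝ × ℝ`
  let c : ℝ → ℝ := fun μ ↦ max 0 (min μ M)
  have hc : Continuous c := by fun_prop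
  have hc0 (μ) : |c μ| ≤ M := abs_le.2 ⟨by linarith [le_max_left 0 (min μ M)],
    max_le hM (min_le_right _ _)⟩
  have hcμ {μ} (hμ : μ ∈ Icc 0 M) : c μ = μ := by
    simp [c, hμ.1, hμ.2]
  let P : ℝ → ℝ → ℝ := fun μ z ↦ Q z - c μ * F z
  have hP : Continuous (Function.uncurry P) := by
    have := hQ.continuous
    have := hF.continuous
    simp only [P, Function.uncurry_def]
    fun_prop
  have hPs (μ) : ContDiff ℝ ∞ (P μ) := hQ.sub (contDiff_const.mul hF)
  have hPb (μ z) : |P μ z| ≤ BQ + M * BF := by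
    refine (abs_sub _ _).trans (add_le_add (hBQ z) ?_)
    rw [abs_mul]
    exact mul_le_mul (hc0 μ) (hBF z) (abs_nonneg _) hM
  obtain ⟨u, hu, hue⟩ := exists_volterra_solution hk.continuous hP hA hPb
  have huc (μ) : Continuous (u μ) := hu.comp (by fun_prop : Continuous fun z ↦ (μ, z))
  let v : ℝ → ℝ → ℝ := fun μ z ↦ k z * segmentAverage (fun r ↦ P μ r * u μ r) z
  have hv : Continuous (Function.uncurry v) :=
    (hk.continuous.comp continuous_snd).mul
      (continuous_segmentAverage_param (h := fun μ r ↦ P μ r * u μ r) (hP.mul hu))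
  have hd (μ z) : HasDerivAt (u μ) (v μ z) z :=
    hasDerivAt_of_volterra hk.continuous (hPs μ).continuous (huc μ) (hue μ) z
  -- the variable `z = 1 - x` moves the pole to `0`
  have hflip : Continuous fun x : ℝ × ℝ ↦ (x.1, 1 - x.2) := by fun_prop
  refine ⟨fun μ x ↦ u μ (1 - x), fun μ x ↦ -v μ (1 - x), hu.comp hflip, (hv.comp hflip).neg,
    η / 3, by positivity, fun μ hμ ↦ ⟨?_, ?_, fun x ↦ ?_, fun x hx ↦ ?_⟩⟩
  · exact (contDiff_of_volterra hk (hPs μ) (huc μ) (hue μ)).comp (contDiff_const.sub contDiff_id)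
  · refine (hue μ (1 - 1)).trans ?_
    simp [volterra]
  · have := (hd μ (1 - x)).comp x ((hasDerivAt_id x).const_sub 1)
    exact this.congr_deriv (by simp)
  · have hmem {y : ℝ} (hy : y ∈ Ioo (-1 / 2) (1 + η / 3)) :
        1 - y ∈ Ioo (0 - η / 3) (3 / 2 + η / 3) := ⟨by linarith [hy.2], by linarith [hy.1]⟩
    have e : (fun x ↦ (1 - x ^ 2) * -v μ (1 - x)) =ᶠ[nhds x]
        fun x ↦ -∫ s in (0 : ℝ)..(1 - x), P μ s * u μ s := by
      filter_upwards [isOpen_Ioo.mem_nhds hx] with y hy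
      rw [← mul_segmentAverage]
      simp only [v]
      rw [hke (hmem hy)]
      have : 2 - (1 - y) ≠ 0 := by linarith [hy.1]
      field_simp
      ring
    have hint := ((hP.comp (by fun_prop : Continuous fun z : ℝ ↦ (μ, z))).mul
      (huc μ)).integral_hasStrictDerivAt 0 (1 - x)
    have h2 := (hint.hasDerivAt.comp x ((hasDerivAt_id x).const_sub 1)).neg
    refine (h2.congr_of_eventuallyEq e).congr_deriv ?_
    simp [P, hcμ hμ, hQe (hmem hx), hFe (hmem hx)]

/-- Uniqueness away from the pole for `((1 - x²) U')' = p U`, written as a first order system for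
`U` and `H = (1 - x²) U'`. -/
theorem eqOn_zero_of_ode {p U H : ℝ → ℝ} {b : ℝ} (hb : b ≤ 1)
    (hp : ContinuousOn p (Icc (-1 / 2) 1))
    (hU : ∀ x ∈ Ioo (-1 / 2) b, HasDerivAt U (H x / (1 - x ^ 2)) x)
    (hH : ∀ x ∈ Ioo (-1 / 2) b, HasDerivAt H (p x * U x) x) {x₀ : ℝ}
    (hx₀ : x₀ ∈ Ioo (-1 / 2) b) (hU0 : U x₀ = 0) (hH0 : H x₀ = 0) :
    ∀ x ∈ Ioo (-1 / 2) b, U x = 0 := by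
  intro y hy
  obtain ⟨B, hB⟩ := isCompact_Icc.exists_bound_of_continuousOn hp
  -- the singular point `1` of the equation is kept away from the interval
  obtain ⟨d, hdb, hdx, hdy⟩ : ∃ d : ℝ, d < b ∧ x₀ < d ∧ y < d := by
    obtain ⟨d, h1, h2⟩ := exists_between (max_lt hx₀.2 hy.2)
    exact ⟨d, h2, (le_max_left _ _).trans_lt h1, (le_max_right _ _).trans_lt h1⟩
  obtain ⟨c, hc1, hdc, hc2⟩ : ∃ c : ℝ, c < 1 ∧ d ≤ c ∧ 1 / 2 ≤ c :=
    ⟨max d (1 / 2), max_lt (hdb.trans_le hb) (by norm_num), le_max_left _ _, le_max_right _ _⟩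
  have hden {t : ℝ} (ht : t ∈ Ioo (-1 / 2) d) : 1 - c ^ 2 ≤ 1 - t ^ 2 := by
    nlinarith [ht.1, ht.2]
  have hc0 : 0 < 1 - c ^ 2 := by nlinarith
  have hsub {t : ℝ} (ht : t ∈ Ioo (-1 / 2) d) : t ∈ Ioo (-1 / 2) b := ⟨ht.1, ht.2.trans hdb⟩
  let K : NNReal := ⟨max (1 - c ^ 2)⁻¹ B, le_max_of_le_left (by positivity)⟩
  let w : ℝ → ℝ × ℝ → ℝ × ℝ := fun t a ↦ (a.2 / (1 - t ^ 2), p t * a.1)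
  have hlip : ∀ t ∈ Ioo (-1 / 2) d, LipschitzOnWith K (w t) univ := by
    intro t ht
    refine (LipschitzWith.of_dist_le_mul fun a b ↦ ?_).lipschitzOnWith
    have h1 : 0 < 1 - t ^ 2 := hc0.trans_le (hden ht)
    have hKc : (K : ℝ) = max (1 - c ^ 2)⁻¹ B := rfl
    rw [Prod.dist_eq]
    refine max_le ?_ ?_
    · have : dist (w t a).1 (w t b).1 = (1 - t ^ 2)⁻¹ * dist a.2 b.2 := by
        simp only [w, Real.dist_eq]
        rw [← sub_div, abs_div, abs_of_pos h1]
        ring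
      rw [this]
      exact mul_le_mul (((inv_le_inv₀ h1 hc0).2 (hden ht)).trans (hKc ▸ le_max_left _ _))
        (le_max_right _ _) dist_nonneg K.2
    · have : dist (w t a).2 (w t b).2 = |p t| * dist a.1 b.1 := by
        simp only [w, Real.dist_eq]
        rw [← mul_sub, abs_mul]
      rw [this]
      refine mul_le_mul ((hB t ⟨ht.1.le, ((hsub ht).2.trans_le hb).le⟩).trans
        (hKc ▸ le_max_right _ _))
        (le_max_left _ _) dist_nonneg K.2
  have hsol := ODE_solution_unique_of_mem_Ioo (v := w) (s := fun _ ↦ univ)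
    (f := fun t ↦ (U t, H t)) (g := fun _ ↦ (0, 0)) hlip (t₀ := x₀) ⟨hx₀.1, hdx⟩
    (fun t ht ↦ ⟨(hU t (hsub ht)).prodMk (hH t (hsub ht)), trivial⟩)
    (fun t _ ↦ ⟨(hasDerivAt_const t ((0 : ℝ), (0 : ℝ))).congr_deriv (by ext <;> simp [w]), trivial⟩)
    (by simp [hU0, hH0])
  exact congrArg Prod.fst (hsol ⟨hy.1, hdy⟩)

/-! ### The hyperbolic tangent -/

theorem hasDerivAt_tanh (t : ℝ) : HasDerivAt Real.tanh (1 - Real.tanh t ^ 2) t := by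
  have h := (Real.hasDerivAt_sinh t).div (Real.hasDerivAt_cosh t) (Real.cosh_pos t).ne'
  have e : Real.tanh = fun t ↦ Real.sinh t / Real.cosh t := funext Real.tanh_eq_sinh_div_cosh
  rw [e]
  refine h.congr_deriv ?_
  have := (Real.cosh_pos t).ne'
  field_simp

theorem tanh_pos {a : ℝ} (ha : 0 < a) : 0 < Real.tanh a := by
  rw [Real.tanh_eq_sinh_div_cosh]
  exact div_pos (Real.sinh_pos_iff.2 ha) (Real.cosh_pos a)

theorem tanh_two_mul (s : ℝ) : Real.tanh (2 * s) = 2 * Real.tanh s / (1 + Real.tanh s ^ 2) := by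
  have h := (Real.cosh_pos s).ne'
  have h2 : Real.cosh s ^ 2 + Real.sinh s ^ 2 ≠ 0 := by positivity
  simp only [Real.tanh_eq_sinh_div_cosh, Real.sinh_two_mul, Real.cosh_two_mul]
  field_simp

theorem one_sub_tanh_sq_le {s : ℝ} (hs : 0 ≤ s) : 1 - Real.tanh s ^ 2 ≤ 1 / (s ^ 2 + 1) := by
  have h := Real.cosh_pos s
  have h1 : 1 - Real.tanh s ^ 2 = 1 / Real.cosh s ^ 2 := by
    rw [Real.tanh_eq_sinh_div_cosh]
    field_simp
    linarith [Real.cosh_sq s]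
  have h2 := Real.self_le_sinh_iff.2 hs
  rw [h1]
  refine one_div_le_one_div_of_le (by positivity) ?_
  rw [Real.cosh_sq]
  nlinarith

theorem tanh_nonneg {t : ℝ} (ht : 0 ≤ t) : 0 ≤ Real.tanh t := by
  rw [Real.tanh_eq_sinh_div_cosh]
  exact div_nonneg (Real.sinh_nonneg_iff.2 ht) (Real.cosh_pos t).le

theorem tanh_mono : Monotone Real.tanh := by
  refine monotone_of_deriv_nonneg (fun t ↦ (hasDerivAt_tanh t).differentiableAt) fun t ↦ ?_
  rw [(hasDerivAt_tanh t).deriv]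
  linarith [Real.tanh_sq_lt_one t]

/-! ### Sturm comparison and shooting -/

/-- Sturm comparison. In the variable `t = artanh x` the equation is `u'' = (1 - x²) p u`; if
`-(1 - x²) p ≥ κ²` on an interval of length `π / κ`, then `u` is not positive on it, because the
Wronskian of `u` and `sin (κ t)` would be nondecreasing, but positive at the left end and negative
at the right end. -/
theorem exists_nonpos_of_oscillation {p U V : ℝ → ℝ} {κ r : ℝ} (hκ : 0 < κ)
    (hr : κ * r = Real.pi) (hU : ∀ x ∈ Icc (0 : ℝ) 1, HasDerivAt U (V x) x)
    (hV : ∀ x ∈ Icc (0 : ℝ) 1, HasDerivAt (fun x ↦ (1 - x ^ 2) * V x) (p x * U x) x)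
    (hosc : ∀ t ∈ Icc 0 r, κ ^ 2 ≤ -((1 - Real.tanh t ^ 2) * p (Real.tanh t))) :
    ∃ x ∈ Icc (0 : ℝ) 1, U x ≤ 0 := by
  by_contra! hpos
  have hr0 : 0 < r := by
    by_contra! h
    nlinarith [Real.pi_pos]
  have hT {t : ℝ} (ht : t ∈ Icc 0 r) : Real.tanh t ∈ Icc (0 : ℝ) 1 :=
    ⟨tanh_nonneg ht.1, (Real.tanh_lt_one t).le⟩
  let H : ℝ → ℝ := fun x ↦ (1 - x ^ 2) * V x
  let W : ℝ → ℝ := fun t ↦ U (Real.tanh t) * (κ * Real.cos (κ * t)) -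
    H (Real.tanh t) * Real.sin (κ * t)
  have hW {t : ℝ} (ht : t ∈ Icc 0 r) : HasDerivAt W (Real.sin (κ * t) * U (Real.tanh t) *
      (-((1 - Real.tanh t ^ 2) * p (Real.tanh t)) - κ ^ 2)) t := by
    have h1 := (hU _ (hT ht)).comp t (hasDerivAt_tanh t)
    have h2 := (hV _ (hT ht)).comp t (hasDerivAt_tanh t)
    have h3 : HasDerivAt (fun t ↦ κ * t) κ t := by simpa using (hasDerivAt_id t).const_mul κ
    refine ((h1.mul (h3.cos.const_mul κ)).sub (h2.mul h3.sin)).congr_deriv ?_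
    simp only [Function.comp_apply]
    ring
  have hmono : MonotoneOn W (Icc 0 r) := by
    refine monotoneOn_of_deriv_nonneg (convex_Icc 0 r)
      (fun t ht ↦ (hW ht).continuousAt.continuousWithinAt)
      (fun t ht ↦ ((hW (interior_subset ht)).differentiableAt).differentiableWithinAt) fun t ht ↦ ?_
    replace ht := interior_subset ht
    rw [(hW ht).deriv]
    refine mul_nonneg (mul_nonneg ?_ (hpos _ (hT ht)).le) (by linarith [hosc t ht])
    refine Real.sin_nonneg_of_nonneg_of_le_pi (mul_nonneg hκ.le ht.1) ?_
    rw [← hr]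
    exact mul_le_mul_of_nonneg_left ht.2 hκ.le
  have h := hmono (left_mem_Icc.2 hr0.le) (right_mem_Icc.2 hr0.le) hr0.le
  have h0 := hpos _ (hT (left_mem_Icc.2 hr0.le))
  have h1 := hpos _ (hT (right_mem_Icc.2 hr0.le))
  simp only [W, hr, Real.cos_pi, Real.sin_pi, mul_zero, Real.cos_zero, Real.sin_zero] at h
  nlinarith [mul_pos hκ h0, mul_pos hκ h1]

/-- For `p ≥ 0` the function `(1 - x²) U U'` is nondecreasing and vanishes at the pole. Hence `U²`
is nonincreasing, and `U² ≥ U(1)² = 1`. -/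
theorem pos_of_nonneg_potential {p U V : ℝ → ℝ} (hp : ∀ x ∈ Icc (0 : ℝ) 1, 0 ≤ p x)
    (hU : ∀ x ∈ Icc (0 : ℝ) 1, HasDerivAt U (V x) x)
    (hV : ∀ x ∈ Icc (0 : ℝ) 1, HasDerivAt (fun x ↦ (1 - x ^ 2) * V x) (p x * U x) x)
    (hU1 : U 1 = 1) : (∀ x ∈ Icc (0 : ℝ) 1, 0 < U x) ∧ V 0 ≤ 0 := by
  have hUc : ContinuousOn U (Icc 0 1) := fun x hx ↦ (hU x hx).continuousAt.continuousWithinAt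
  let G : ℝ → ℝ := fun x ↦ (1 - x ^ 2) * V x * U x
  have hG (x) (hx : x ∈ Icc (0 : ℝ) 1) := (hV x hx).mul (hU x hx)
  have hGmono : MonotoneOn G (Icc 0 1) := by
    refine monotoneOn_of_deriv_nonneg (convex_Icc 0 1)
      (fun x hx ↦ (hG x hx).continuousAt.continuousWithinAt)
      (fun x hx ↦ (hG x (interior_subset hx)).differentiableAt.differentiableWithinAt) fun x hx ↦ ?_
    replace hx := interior_subset hx
    refine ((hG x hx).deriv).symm ▸ ?_
    have h1 : 0 ≤ 1 - x ^ 2 := by nlinarith [hx.1, hx.2]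
    have h2 := mul_nonneg (hp x hx) (sq_nonneg (U x))
    have h3 := mul_nonneg h1 (sq_nonneg (V x))
    nlinarith
  have hG0 (x) (hx : x ∈ Icc (0 : ℝ) 1) : G x ≤ 0 :=
    (hGmono hx (right_mem_Icc.2 zero_le_one) hx.2).trans (by simp [G])
  have hsq : AntitoneOn (fun x ↦ U x ^ 2) (Icc 0 1) := by
    refine antitoneOn_of_deriv_nonpos (convex_Icc 0 1) (hUc.pow 2)
      (fun x hx ↦ ((hU x (interior_subset hx)).pow 2).differentiableAt.differentiableWithinAt)
      fun x hx ↦ ?_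
    have h := ((hU x (interior_subset hx)).pow 2).deriv
    have h' := hG0 x (interior_subset hx)
    rw [interior_Icc] at hx
    refine h.symm ▸ ?_
    have h1 : 0 < 1 - x ^ 2 := by nlinarith [hx.1, hx.2]
    have h2 : V x * U x ≤ 0 := by
      by_contra! hc
      have := mul_pos h1 hc
      simp only [G] at h'
      linarith
    simp
    linarith
  have hne (x) (hx : x ∈ Icc (0 : ℝ) 1) : 1 ≤ U x ^ 2 := by
    have := hsq hx (right_mem_Icc.2 zero_le_one) hx.2
    simpa [hU1] using this
  have hpos : ∀ x ∈ Icc (0 : ℝ) 1, 0 < U x := by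
    intro x hx
    by_contra! hc
    obtain ⟨y, hy, hy0⟩ := intermediate_value_Icc hx.2
      (hUc.mono (Icc_subset_Icc_left hx.1))
        (show (0 : ℝ) ∈ Icc (U x) (U 1) from ⟨hc, by simp [hU1]⟩)
    have := hne y ⟨hx.1.trans hy.1, hy.2⟩
    rw [hy0] at this
    norm_num at this
  refine ⟨hpos, ?_⟩
  have h := hG0 0 (left_mem_Icc.2 zero_le_one)
  by_contra! hc
  have := mul_pos hc (hpos 0 (left_mem_Icc.2 zero_le_one))
  simp [G] at h
  linarith

/-- `U` is smooth and solves `((1 - x²) U')' = p U` on `[-1, 1]`. -/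
def SolvesLegendre (p U : ℝ → ℝ) : Prop :=
  ContDiff ℝ ∞ U ∧ ∀ x ∈ Icc (-1 : ℝ) 1,
    (1 - x ^ 2) * deriv (deriv U) x - 2 * x * deriv U x = p x * U x

/-- A solution that is regular at the pole `1` and satisfies the Neumann condition (`s = 1`) or the
Dirichlet condition (`s = -1`) at the equator continues, by even or odd reflection, to a solution on
all of `[-1, 1]`. -/
theorem exists_reflected_solution {p U V : ℝ → ℝ} {ε s : ℝ} (hε : 0 < ε) (hs : s * s = 1)
    (hp : ContinuousOn p (Icc (-1) 1)) (hpe : ∀ x, p (-x) = p x) (hUs : ContDiff ℝ ∞ U)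
    (hU : ∀ x, HasDerivAt U (V x) x)
    (hV : ∀ x ∈ Ioo (-1 / 2) (1 + ε), HasDerivAt (fun x ↦ (1 - x ^ 2) * V x) (p x * U x) x)
    (hU0 : U 0 = s * U 0) (hV0 : V 0 = -s * V 0) :
    ∃ F : ℝ → ℝ, SolvesLegendre p F ∧ F 1 = U 1 ∧ ∀ x, F (-x) = s * F x := by
  have hsymm : ∀ x ∈ Ioo (-1 / 2 : ℝ) (1 / 2), U x = s * U (-x) := by
    -- both sides solve the same equation with the same initial values at `0`
    have hsub {x : ℝ} (hx : x ∈ Ioo (-1 / 2 : ℝ) (1 / 2)) : x ∈ Ioo (-1 / 2) (1 + ε) :=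
      ⟨hx.1, by linarith [hx.2]⟩
    have hneg {x : ℝ} (hx : x ∈ Ioo (-1 / 2 : ℝ) (1 / 2)) : -x ∈ Ioo (-1 / 2 : ℝ) (1 / 2) :=
      ⟨by linarith [hx.2], by linarith [hx.1]⟩
    have hzero := eqOn_zero_of_ode (p := p) (b := 1 / 2) (x₀ := 0) (U := fun x ↦ U x - s * U (-x))
      (H := fun x ↦ (1 - x ^ 2) * V x + s * ((1 - (-x) ^ 2) * V (-x))) (by norm_num)
      (hp.mono (Icc_subset_Icc_left (by norm_num)))
      (fun x hx ↦ by
        have h1 := (hU x).sub (((hU (-x)).comp x (hasDerivAt_neg x)).const_mul s)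
        refine h1.congr_deriv ?_
        have : 1 - x ^ 2 ≠ 0 := by nlinarith [hx.1, hx.2]
        field_simp
        ring)
      (fun x hx ↦ by
        have h1 := (hV x (hsub hx)).add
          (((hV (-x) (hsub (hneg hx))).comp x (hasDerivAt_neg x)).const_mul s)
        refine h1.congr_deriv ?_
        rw [hpe]
        ring)
      (by norm_num) (by simp; linarith) (by simp; linarith)
    exact fun x hx ↦ sub_eq_zero.1 (hzero x hx)
  let F : ℝ → ℝ := fun x ↦ if 0 ≤ x then U x else s * U (-x)
  have hF1 : ∀ x ∈ Ioi (-1 / 2 : ℝ), F x = U x := by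
    intro x hx
    simp only [F]
    split_ifs with h
    · rfl
    · exact (hsymm x ⟨hx, by linarith⟩).symm
  have hF2 : ∀ x, F (-x) = s * F x := by
    intro x
    rcases lt_trichotomy x 0 with h | rfl | h
    · simp only [F]
      rw [if_pos (by linarith), if_neg (by linarith), ← mul_assoc, hs, one_mul]
    · simpa [F] using hU0
    · simp only [F]
      rw [if_neg (by linarith), if_pos h.le, neg_neg]
  have hF3 : F = fun x ↦ s * F (-x) := by
    funext x
    rw [hF2, ← mul_assoc, hs, one_mul]
  have hloc {x : ℝ} (hx : -1 / 2 < x) : F =ᶠ[nhds x] U :=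
    (isOpen_Ioi.mem_nhds hx : Ioi (-1 / 2 : ℝ) ∈ nhds x) |> Filter.mem_of_superset <| hF1
  have hFs : ContDiff ℝ ∞ F := by
    rw [contDiff_iff_contDiffAt]
    intro x
    by_cases hx : -1 / 2 < x
    · exact hUs.contDiffAt.congr_of_eventuallyEq (hloc hx)
    · rw [hF3]
      have h1 : ContDiffAt ℝ ∞ F (-x) :=
        hUs.contDiffAt.congr_of_eventuallyEq (hloc (by linarith))
      exact contDiffAt_const.mul (h1.comp x contDiffAt_id.neg)
  have hode : ∀ x ∈ Icc (0 : ℝ) 1,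
      (1 - x ^ 2) * deriv (deriv F) x - 2 * x * deriv F x = p x * F x := by
    intro x hx
    have hx' : -1 / 2 < x := by linarith [hx.1]
    have hdU : deriv U = V := funext fun y ↦ (hU y).deriv
    rw [(hloc hx').eq_of_nhds, (hloc hx').deriv_eq, (hloc hx').deriv.deriv_eq, hdU]
    have hVd : HasDerivAt V (deriv V x) x := by
      rw [← hdU]
      exact (differentiableAt_deriv_of_contDiffAt
        (hUs.contDiffAt.of_le ENat.LEInfty.out)).hasDerivAt
    have h1 := (((hasDerivAt_id x).pow 2).const_sub 1).mul hVd
    have h2 := hV x ⟨hx', by linarith [hx.2]⟩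
    have h3 := h2.unique h1
    simp at h3
    linarith
  refine ⟨F, ⟨hFs, fun x hx ↦ ?_⟩, hF1 1 (by norm_num [mem_Ioi]), hF2⟩
  by_cases h0 : 0 ≤ x
  · exact hode x ⟨h0, hx.2⟩
  · have h1 := hode (-x) ⟨by linarith, by linarith [hx.1]⟩
    have hd (y : ℝ) : deriv F y = -(s * deriv F (-y)) := by
      conv_lhs => rw [hF3]
      rw [deriv_const_mul_field, deriv_comp_neg]
      ring
    have hd2 : deriv (deriv F) x = s * deriv (deriv F) (-x) := by
      conv_lhs => rw [funext hd]
      rw [deriv.fun_neg, deriv_const_mul_field, deriv_comp_neg]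
      ring
    rw [hd x, hd2, ← hpe x]
    have h2 : F x = s * F (-x) := congrFun hF3 x
    rw [h2]
    linear_combination s * h1

/-- Shooting from the pole. The regular solution `U μ` is positive on the hemisphere for `μ = 0`,
but not for `μ = M`. The first parameter `μ₁` at which its minimum vanishes gives an odd solution:
the zero is at the equator. Since `(U μ)'(0)` is nonpositive for `μ = 0` and nonnegative for `μ₁`,
it vanishes for some `μ₀` in between, which gives an even solution. -/
theorem exists_even_and_odd_solution {q f : ℝ → ℝ} {δ M κ r : ℝ} (hδ : 0 < δ) (hM : 0 ≤ M)
    (hq : ContDiffOn ℝ ∞ q (Ioo (-1 - δ) (1 + δ))) (hf : ContDiffOn ℝ ∞ f (Ioo (-1 - δ) (1 + δ)))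
    (hqe : ∀ x, q (-x) = q x) (hfe : ∀ x, f (-x) = f x)
    (hq0 : ∀ x ∈ Icc (0 : ℝ) 1, 0 ≤ q x) (hκ : 0 < κ) (hr : κ * r = Real.pi)
    (hosc : ∀ t ∈ Icc 0 r, κ ^ 2 ≤
      (1 - Real.tanh t ^ 2) * (M * f (Real.tanh t) - q (Real.tanh t))) :
    (∃ μ ∈ Icc 0 M, ∃ U, SolvesLegendre (fun x ↦ q x - μ * f x) U ∧ U 1 = 1 ∧
      ∀ x, U (-x) = U x) ∧
    ∃ μ ∈ Icc 0 M, ∃ U, SolvesLegendre (fun x ↦ q x - μ * f x) U ∧ U 1 = 1 ∧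
      ∀ x, U (-x) = -U x := by
  obtain ⟨U, V, hUc, hVc, ε, hε, hUV⟩ := exists_regular_solutions hδ hM hq hf
  have hsub : Icc (-1 : ℝ) 1 ⊆ Ioo (-1 - δ) (1 + δ) := fun x hx ↦
    ⟨by linarith [hx.1], by linarith [hx.2]⟩
  have hpc (μ : ℝ) : ContinuousOn (fun x ↦ q x - μ * f x) (Icc (-1) 1) :=
    (hq.continuousOn.mono hsub).sub (continuousOn_const.mul (hf.continuousOn.mono hsub))
  have hpe (μ x : ℝ) : q (-x) - μ * f (-x) = q x - μ * f x := by rw [hqe, hfe]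
  have hUc' (μ : ℝ) : Continuous (U μ) := hUc.comp (by fun_prop : Continuous fun x ↦ (μ, x))
  have hI {x : ℝ} (hx : x ∈ Icc (0 : ℝ) 1) : x ∈ Ioo (-1 / 2) (1 + ε) :=
    ⟨by linarith [hx.1], by linarith [hx.2]⟩
  have h0M : (0 : ℝ) ∈ Icc 0 M := left_mem_Icc.2 hM
  have hMM : M ∈ Icc 0 M := right_mem_Icc.2 hM
  obtain ⟨hpos, hV0⟩ := pos_of_nonneg_potential (p := fun x ↦ q x - 0 * f x)
    (fun x hx ↦ by simpa using hq0 x hx) (fun x _ ↦ (hUV 0 h0M).2.2.1 x)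
    (fun x hx ↦ (hUV 0 h0M).2.2.2 x (hI hx)) (hUV 0 h0M).2.1
  obtain ⟨xM, hxM, hUM⟩ := exists_nonpos_of_oscillation (p := fun x ↦ q x - M * f x) hκ hr
    (fun x _ ↦ (hUV M hMM).2.2.1 x) (fun x hx ↦ (hUV M hMM).2.2.2 x (hI hx))
    (fun t ht ↦ (hosc t ht).trans (le_of_eq (by ring)))
  -- the minimum over the northern hemisphere is continuous in `μ`
  let m : ℝ → ℝ := fun μ ↦ sInf (U μ '' Icc 0 1)
  have hm : Continuous m := (isCompact_Icc (a := (0 : ℝ)) (b := 1)).continuous_sInf hUc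
  have hmin (μ : ℝ) : ∃ x ∈ Icc (0 : ℝ) 1, m μ = U μ x ∧ ∀ y ∈ Icc (0 : ℝ) 1, U μ x ≤ U μ y := by
    obtain ⟨x, hx, h1, h2⟩ := isCompact_Icc.exists_sInf_image_eq_and_le
      (nonempty_Icc.2 (zero_le_one (α := ℝ))) (hUc' μ).continuousOn
    exact ⟨x, hx, h1, h2⟩
  have hm0 : 0 ≤ m 0 := by
    obtain ⟨x, hx, h1, -⟩ := hmin 0
    rw [h1]
    exact (hpos x hx).le
  have hmM : m M ≤ 0 := by
    obtain ⟨x, -, h1, h2⟩ := hmin M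
    rw [h1]
    exact (h2 xM hxM).trans hUM
  obtain ⟨μ₁, hμ₁, hmμ⟩ := intermediate_value_Icc' hM hm.continuousOn
    (show (0 : ℝ) ∈ Icc (m M) (m 0) from ⟨hmM, hm0⟩)
  obtain ⟨hUs, hU1, hUd, hUode⟩ := hUV μ₁ hμ₁
  obtain ⟨x₀, hx₀, hx₀m, hx₀min⟩ := hmin μ₁
  rw [hmμ] at hx₀m
  -- an interior zero of the nonnegative `U` would be a double zero
  have hx₀0 : x₀ = 0 := by
    by_contra hne
    have hx₀pos : 0 < x₀ := lt_of_le_of_ne hx₀.1 (Ne.symm hne)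
    have hx₀lt : x₀ < 1 := by
      refine lt_of_le_of_ne hx₀.2 fun h ↦ ?_
      rw [h, hU1] at hx₀m
      norm_num at hx₀m
    have hloc : IsLocalMin (U μ₁) x₀ := by
      filter_upwards [Icc_mem_nhds hx₀pos hx₀lt] with y hy using hx₀min y hy
    have hVx : V μ₁ x₀ = 0 := hloc.hasDerivAt_eq_zero (hUd x₀)
    have hzero := eqOn_zero_of_ode le_rfl (p := fun x ↦ q x - μ₁ * f x) (U := U μ₁)
      (H := fun x ↦ (1 - x ^ 2) * V μ₁ x) ((hpc μ₁).mono (Icc_subset_Icc_left (by norm_num)))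
      (fun x hx ↦ (hUd x).congr_deriv (by
        have : 1 - x ^ 2 ≠ 0 := by nlinarith [hx.1, hx.2]
        field_simp))
      (fun x hx ↦ hUode x ⟨hx.1, by linarith [hx.2]⟩) ⟨by linarith, hx₀lt⟩ hx₀m.symm (by simp [hVx])
    have hlim : Filter.Tendsto (U μ₁) (nhdsWithin 1 (Iio 1)) (nhds 0) := by
      refine tendsto_const_nhds.congr' ?_
      filter_upwards [Ioo_mem_nhdsLT (show (-1 / 2 : ℝ) < 1 by norm_num)] with y hy
      exact (hzero y hy).symm
    have := tendsto_nhds_unique hlim ((hUc' μ₁).continuousAt.tendsto.mono_left nhdsWithin_le_nhds)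
    rw [hU1] at this
    norm_num at this
  subst hx₀0
  have hV1 : 0 ≤ V μ₁ 0 := by
    have hmn : IsMinOn (U μ₁) (Icc 0 1) 0 := fun y hy ↦ hx₀min y hy
    have := hmn.localize.hasFDerivWithinAt_nonneg
      (hUd 0).hasFDerivAt.hasFDerivWithinAt (y := 1)
      (mem_posTangentConeAt_of_segment_subset (by simp [segment_eq_Icc]))
    simpa using this
  have hVc0 : Continuous fun μ ↦ V μ 0 := hVc.comp (by fun_prop : Continuous fun μ : ℝ ↦
    (μ, (0 : ℝ)))
  obtain ⟨μ₀, hμ₀, hVμ₀⟩ := intermediate_value_Icc hμ₁.1 hVc0.continuousOn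
    (show (0 : ℝ) ∈ Icc (V 0 0) (V μ₁ 0) from ⟨hV0, hV1⟩)
  have hμ₀M : μ₀ ∈ Icc 0 M := ⟨hμ₀.1, hμ₀.2.trans hμ₁.2⟩
  constructor
  · obtain ⟨hUs', hU1', hUd', hUode'⟩ := hUV μ₀ hμ₀M
    obtain ⟨F, hF, hF1, hFs⟩ := exists_reflected_solution (s := 1) hε (by norm_num) (hpc μ₀)
      (hpe μ₀)
      hUs' hUd' hUode' (by simp) (by simp [hVμ₀])
    exact ⟨μ₀, hμ₀M, F, hF, hF1.trans hU1', by simpa using hFs⟩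
  · obtain ⟨F, hF, hF1, hFs⟩ := exists_reflected_solution (s := -1) hε (by norm_num) (hpc μ₁)
      (hpe μ₁)
      hUs hUd hUode (by simp [← hx₀m]) (by simp)
    exact ⟨μ₁, hμ₁, F, hF, hF1.trans hU1, by simpa using hFs⟩

end SturmLiouville

/-! ### The sausage metrics -/

section Sausage

open MeasureTheory Set

attribute [local instance] fact_finrank_space

/-- The function `f` in the metric `f(x₃) g_round` of a sausage of half length `a`. -/
def sausageFactor (a x : ℝ) : ℝ := Real.tanh a / a / (1 - Real.tanh a ^ 2 * x ^ 2)

/-- The product `K f` of the Gauss curvature and the conformal factor of the sausage metric. -/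
def sausageCurvature (a x : ℝ) : ℝ :=
  (1 - Real.tanh a ^ 2) * (1 + Real.tanh a ^ 2 * x ^ 2) / (1 - Real.tanh a ^ 2 * x ^ 2) ^ 2

theorem one_sub_tanh_sq_mul_pos (a : ℝ) {x : ℝ} (hx : x ^ 2 ≤ 1) :
    0 < 1 - Real.tanh a ^ 2 * x ^ 2 := by
  nlinarith [Real.tanh_sq_lt_one a, sq_nonneg (Real.tanh a)]

theorem sq_height_le_one (p : S2) : (p : Space) 2 ^ 2 ≤ 1 := by
  have h : ‖(p : Space)‖ = 1 := by simp
  have h2 := EuclideanSpace.real_norm_sq_eq (p : Space)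
  rw [h, Fin.sum_univ_three] at h2
  nlinarith [sq_nonneg ((p : Space) 0), sq_nonneg ((p : Space) 1)]

theorem sausageFactor_pos {a x : ℝ} (ha : 0 < a) (hx : x ^ 2 ≤ 1) : 0 < sausageFactor a x :=
  div_pos (div_pos (tanh_pos ha) ha) (one_sub_tanh_sq_mul_pos a hx)

theorem contDiffAt_sausageFactor {a x : ℝ} (hx : 1 - Real.tanh a ^ 2 * x ^ 2 ≠ 0) :
    ContDiffAt ℝ ∞ (sausageFactor a) x :=
  contDiffAt_const.div (by fun_prop) hx

theorem contDiffAt_sausageCurvature {a x : ℝ} (hx : 1 - Real.tanh a ^ 2 * x ^ 2 ≠ 0) :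
    ContDiffAt ℝ ∞ (sausageCurvature a) x :=
  ContDiffAt.div (by fun_prop) (by fun_prop) (pow_ne_zero 2 hx)

theorem contMDiff_height : ContMDiff (𝓡 2) 𝓘(ℝ, ℝ) ∞ fun p : S2 ↦ (p : Space) 2 :=
  (EuclideanSpace.proj (𝕜 := ℝ) (2 : Fin 3)).contDiff.contMDiff.comp
    (contMDiff_coe_sphere (n := 2) (E := Space))

theorem contMDiff_sausageFactor (a : ℝ) :
    ContMDiff (𝓡 2) 𝓘(ℝ, ℝ) ∞ fun p : S2 ↦ sausageFactor a ((p : Space) 2) := fun p ↦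
  (contDiffAt_sausageFactor (one_sub_tanh_sq_mul_pos a (sq_height_le_one p)).ne').contMDiffAt.comp
    (g := sausageFactor a) p (contMDiff_height p)

/-- The King–Rosenau (sausage) metric, normalized to area `4π`. In the cylindrical coordinates
`x₃ = tanh t` it is `(tanh (t + a) - tanh (t - a)) / (2 a) · (dt² + dθ²)`. -/
def sausageMetric (a : ℝ) (ha : 0 < a) : RiemMetric :=
  conformalMetric (fun p ↦ sausageFactor a ((p : Space) 2)) (contMDiff_sausageFactor a)
    (fun p ↦ sausageFactor_pos ha (sq_height_le_one p))

theorem hasDerivAt_log_sausageFactor {a x : ℝ} (ha : 0 < a) (hx : 1 - Real.tanh a ^ 2 * x ^ 2 ≠ 0) :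
    HasDerivAt (fun t ↦ Real.log (sausageFactor a t))
      (2 * Real.tanh a ^ 2 * x / (1 - Real.tanh a ^ 2 * x ^ 2)) x := by
  have h1 : HasDerivAt (fun t ↦ 1 - Real.tanh a ^ 2 * t ^ 2) (-(Real.tanh a ^ 2 * (2 * x))) x := by
    simpa using (((hasDerivAt_id x).pow 2).const_mul (Real.tanh a ^ 2)).const_sub 1
  have h0 : Real.tanh a / a ≠ 0 := (div_pos (tanh_pos ha) ha).ne'
  have h2 := (((hasDerivAt_const x (Real.tanh a / a)).div h1 hx).log (div_ne_zero h0 hx))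
  refine h2.congr_deriv ?_
  have := (tanh_pos ha).ne'
  simp only [Pi.div_apply]
  field_simp
  ring

theorem gaussCurvature_sausageMetric {a : ℝ} (ha : 0 < a) (p : S2) :
    gaussCurvature (sausageMetric a ha) p =
      (sausageFactor a ((p : Space) 2))⁻¹ * sausageCurvature a ((p : Space) 2) := by
  have hx := (one_sub_tanh_sq_mul_pos a (sq_height_le_one p)).ne'
  rw [sausageMetric, gaussCurvature_conformalMetric _ _ (f := sausageFactor a) (fun _ ↦ rfl) p
    ((contDiffAt_sausageFactor hx).of_le ENat.LEInfty.out)]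
  set x := (p : Space) 2
  have hd : deriv (fun t ↦ Real.log (sausageFactor a t)) =ᶠ[nhds x] fun t ↦
      2 * Real.tanh a ^ 2 * t / (1 - Real.tanh a ^ 2 * t ^ 2) := by
    have : ∀ᶠ t in nhds x, 1 - Real.tanh a ^ 2 * t ^ 2 ≠ 0 :=
      (show ContinuousAt (fun t ↦ 1 - Real.tanh a ^ 2 * t ^ 2) x by fun_prop).eventually_ne hx
    filter_upwards [this] with t ht using (hasDerivAt_log_sausageFactor ha ht).deriv
  have h1 : HasDerivAt (fun t ↦ 1 - Real.tanh a ^ 2 * t ^ 2) (-(Real.tanh a ^ 2 * (2 * x))) x := by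
    simpa using (((hasDerivAt_id x).pow 2).const_mul (Real.tanh a ^ 2)).const_sub 1
  have h2 := ((hasDerivAt_id x).const_mul (2 * Real.tanh a ^ 2)).div h1 hx
  rw [hd.deriv_eq, hd.eq_of_nhds]
  erw [h2.deriv]
  congr 1
  simp only [sausageCurvature, id]
  rw [eq_div_iff (pow_ne_zero 2 hx)]
  generalize hD : 1 - Real.tanh a ^ 2 * x ^ 2 = D at hx ⊢
  field_simp
  rw [← hD]
  ring

theorem gaussCurvature_sausageMetric_pos {a : ℝ} (ha : 0 < a) (p : S2) :
    0 < gaussCurvature (sausageMetric a ha) p := by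
  rw [gaussCurvature_sausageMetric]
  have h1 := sausageFactor_pos ha (sq_height_le_one p)
  have h2 := one_sub_tanh_sq_mul_pos a (sq_height_le_one p)
  have h3 : 0 < 1 - Real.tanh a ^ 2 := by linarith [Real.tanh_sq_lt_one a]
  unfold sausageCurvature
  positivity

theorem solvesEigenEquation_of_solvesLegendre {a : ℝ} (ha : 0 < a) {α μ : ℝ} {U : ℝ → ℝ}
    (hU : SolvesLegendre (fun x ↦ α * sausageCurvature a x - μ * sausageFactor a x) U) :
    SolvesEigenEquation (sausageMetric a ha) α μ fun p ↦ U ((p : Space) 2) := by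
  refine ⟨hU.1.contMDiff.comp contMDiff_height, fun p ↦ ?_⟩
  have hf := (sausageFactor_pos ha (sq_height_le_one p)).ne'
  have h1 := abs_le.1 ((sq_le_one_iff_abs_le_one _).1 (sq_height_le_one p))
  have h2 := flatLaplacian_comp_chartHeight p (U := U) (hU.1.contDiffAt.of_le ENat.LEInfty.out)
  rw [hU.2 _ h1] at h2
  rw [gaussCurvature_sausageMetric, sausageMetric, laplacian_conformalMetric]
  erw [h2]
  field_simp
  ring

/-- For `|t| ≤ a / 2` the metric is comparable to `(dt² + dθ²) / a`. -/
theorem le_mul_sausageFactor {a t : ℝ} (ha : 1 ≤ a) (ht : t ∈ Icc 0 (a / 2)) :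
    1 / (4 * a) ≤ (1 - Real.tanh t ^ 2) * sausageFactor a (Real.tanh t) := by
  have hT : 1 / 2 ≤ Real.tanh a := by
    have h := one_sub_tanh_sq_le (s := a) (by linarith)
    have h1 : 1 / (a ^ 2 + 1) ≤ 1 / 2 := one_div_le_one_div_of_le (by norm_num) (by nlinarith)
    nlinarith [tanh_pos (a := a) (by linarith)]
  have hTm : Real.tanh a = 2 * Real.tanh (a / 2) / (1 + Real.tanh (a / 2) ^ 2) := by
    rw [← tanh_two_mul]
    ring_nf
  have hx0 := tanh_nonneg ht.1
  have hxm := tanh_mono ht.2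
  have hm1 := Real.tanh_lt_one (a / 2)
  set x := Real.tanh t
  set m := Real.tanh (a / 2)
  have hx1 : x ^ 2 ≤ 1 := by nlinarith
  have hD := one_sub_tanh_sq_mul_pos a hx1
  set T := Real.tanh a
  -- this uses `T = 2 m / (1 + m ^ 2)` and `x ≤ m`
  have key : x ^ 2 * (2 - T ^ 2) ≤ 1 := by
    have h0 : 0 ≤ 2 - T ^ 2 := by linarith [Real.tanh_sq_lt_one a]
    have h1 : m ^ 2 * (2 - T ^ 2) ≤ 1 := by
      have hy : m ^ 2 ≤ 1 := by nlinarith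
      have hy0 := sq_nonneg m
      rw [hTm, div_pow, ← sub_nonneg]
      have : 1 - m ^ 2 * (2 - (2 * m) ^ 2 / (1 + m ^ 2) ^ 2) =
          (1 + (m ^ 2) ^ 2 - 2 * (m ^ 2) ^ 3) / (1 + m ^ 2) ^ 2 := by
        field_simp
        ring
      rw [this]
      refine div_nonneg ?_ (by positivity)
      nlinarith [mul_nonneg hy0 (sub_nonneg.2 hy), mul_nonneg (sq_nonneg (m ^ 2)) (sub_nonneg.2 hy)]
    have h2 : x ^ 2 ≤ m ^ 2 := by gcongr
    nlinarith
  have e : (1 - x ^ 2) * sausageFactor a x = T / a * ((1 - x ^ 2) / (1 - T ^ 2 * x ^ 2)) := by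
    simp only [sausageFactor]
    ring
  have h3 : 1 / 2 ≤ (1 - x ^ 2) / (1 - T ^ 2 * x ^ 2) := by
    rw [le_div_iff₀ hD]
    linarith
  have h4 : 1 / 2 / a ≤ T / a := by gcongr
  calc 1 / (4 * a) = 1 / 2 / a * (1 / 2) := by field_simp; norm_num
    _ ≤ _ := by
      rw [e]
      exact mul_le_mul h4 h3 (by norm_num) (by positivity)

/-- For `|t| ≤ a / 2` the sausage is nearly flat. -/
theorem mul_sausageCurvature_le {a t : ℝ} (ha : 0 < a) (ht : t ∈ Icc 0 (a / 2)) :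
    (1 - Real.tanh t ^ 2) * sausageCurvature a (Real.tanh t) ≤ 8 / a ^ 2 := by
  have hTm : Real.tanh a = 2 * Real.tanh (a / 2) / (1 + Real.tanh (a / 2) ^ 2) := by
    rw [← tanh_two_mul]
    ring_nf
  have hx0 := tanh_nonneg ht.1
  have hxm := tanh_mono ht.2
  have hm1 := Real.tanh_lt_one (a / 2)
  have hm : 1 - Real.tanh (a / 2) ^ 2 ≤ 1 / (a / 2) ^ 2 :=
    (one_sub_tanh_sq_le (half_pos ha).le).trans
      (one_div_le_one_div_of_le (by positivity) (by linarith))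
  have hT1 := Real.tanh_sq_lt_one a
  set x := Real.tanh t
  set m := Real.tanh (a / 2)
  have hx1 : x ^ 2 ≤ 1 := by nlinarith
  have hD := one_sub_tanh_sq_mul_pos a hx1
  set T := Real.tanh a
  have hxD : 1 - x ^ 2 ≤ 1 - T ^ 2 * x ^ 2 := by nlinarith [sq_nonneg x]
  have hmx : 1 - m ^ 2 ≤ 1 - x ^ 2 := by
    have : x ^ 2 ≤ m ^ 2 := by gcongr
    linarith
  have hTe : 1 - T ^ 2 = (1 - m ^ 2) * ((1 - m ^ 2) / (1 + m ^ 2) ^ 2) := by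
    rw [hTm]
    field_simp
    ring
  have hm0 : 0 < 1 - m ^ 2 := by nlinarith
  have h1 : 1 - T ^ 2 ≤ (1 - m ^ 2) * (1 - T ^ 2 * x ^ 2) := by
    rw [hTe]
    refine mul_le_mul_of_nonneg_left ?_ hm0.le
    rw [div_le_iff₀ (by positivity)]
    nlinarith [sq_nonneg m, mul_nonneg (sq_nonneg m) hD.le, mul_nonneg (sq_nonneg (m ^ 2)) hD.le]
  have h2 : (1 - x ^ 2) * sausageCurvature a x ≤ 2 * (1 - m ^ 2) := by
    simp only [sausageCurvature]
    rw [← mul_div_assoc, div_le_iff₀ (by positivity)]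
    have h3 : 0 ≤ 1 - T ^ 2 := by linarith
    have h4 : 0 ≤ 1 - x ^ 2 := by linarith
    have h5 : 1 + T ^ 2 * x ^ 2 ≤ 2 := by nlinarith [sq_nonneg x]
    calc (1 - x ^ 2) * ((1 - T ^ 2) * (1 + T ^ 2 * x ^ 2))
        ≤ (1 - T ^ 2 * x ^ 2) * (((1 - m ^ 2) * (1 - T ^ 2 * x ^ 2)) * 2) := by gcongr
      _ = _ := by ring
  refine h2.trans ?_
  have : 8 / a ^ 2 = 2 * (1 / (a / 2) ^ 2) := by field_simp; norm_num
  rw [this]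
  linarith

/-- The oscillation condition for `M = (16 π² + 32 α) / a` on the interval `[0, a / 2]`, whose
length is `π / κ` for `κ = 2 π / a`. -/
theorem lower_bound_potential {a t α : ℝ} (ha : 1 ≤ a) (hα : 0 ≤ α) (ht : t ∈ Icc 0 (a / 2)) :
    (2 * Real.pi / a) ^ 2 ≤ (1 - Real.tanh t ^ 2) *
      ((16 * Real.pi ^ 2 + 32 * α) / a * sausageFactor a (Real.tanh t)
        - α * sausageCurvature a (Real.tanh t)) := by
  have ha0 : 0 < a := by linarith
  have h1 := mul_le_mul_of_nonneg_left (le_mul_sausageFactor ha ht)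
    (show 0 ≤ (16 * Real.pi ^ 2 + 32 * α) / a by positivity)
  have h2 := mul_le_mul_of_nonneg_left (mul_sausageCurvature_le ha0 ht) hα
  have h3 : (2 * Real.pi / a) ^ 2 =
      (16 * Real.pi ^ 2 + 32 * α) / a * (1 / (4 * a)) - α * (8 / a ^ 2) := by
    field_simp
    ring
  rw [h3]
  linarith

/-- In polar coordinates the area density has an explicit primitive, a multiple of
`artanh (tanh a · x₃)`; the factor `1 / a` in the metric makes the total area `4π`. -/
theorem area_sausageMetric {a : ℝ} (ha : 0 < a) :
    area (sausageMetric a ha) = ENNReal.ofReal (4 * Real.pi) := by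
  obtain ⟨J, hJp, hJ⟩ := exists_chart_symm_eq northPole
  have hJ2 (y : Plane) : J y 2 = 0 := by
    have := hJp y
    simpa [northPole, EuclideanSpace.inner_single_right] using this
  let h : ℝ → ℝ := fun r ↦ 8 / (r ^ 2 + 4) - 1
  let g : ℝ → ℝ := fun r ↦ sausageFactor a (h r) * (16 / (r ^ 2 + 4) ^ 2)
  have hh (r : ℝ) : h r ^ 2 ≤ 1 := by
    have h0 : 0 < r ^ 2 + 4 := by positivity
    have h1 : 0 ≤ 8 / (r ^ 2 + 4) := by positivity
    have h2 : 8 / (r ^ 2 + 4) ≤ 2 := by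
      rw [div_le_iff₀ h0]
      nlinarith [sq_nonneg r]
    simp only [h]
    nlinarith
  have hg0 (r : ℝ) : 0 ≤ g r := mul_nonneg (sausageFactor_pos ha (hh r)).le (by positivity)
  have hsqrt (y : Plane) : Real.sqrt (gram (sausageMetric a ha) northPole y).det = g ‖y‖ := by
    have e : (((extChartAt (𝓡 2) northPole).symm y : S2) : Space) 2 = h ‖y‖ := by
      have h0 : ‖y‖ ^ 2 + 4 ≠ 0 := by positivity
      rw [hJ]
      simp [hJ2, h, northPole]
      field_simp
      ring
    rw [sausageMetric, gram_conformalMetric, e]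
    change Real.sqrt (g ‖y‖ • (1 : Matrix (Fin 2) (Fin 2) ℝ)).det = g ‖y‖
    simp [Real.sqrt_sq (hg0 _)]
  set T := Real.tanh a with hTdef
  have hT := tanh_pos ha
  have hT1 := Real.tanh_lt_one a
  let G : ℝ → ℝ := fun r ↦ (Real.log (1 - T * h r) - Real.log (1 + T * h r)) / (2 * a)
  have hTh (r : ℝ) : 0 < 1 - T * h r ∧ 0 < 1 + T * h r := by
    have := abs_le.1 ((sq_le_one_iff_abs_le_one _).1 (hh r))
    constructor <;> nlinarith
  have hG (r : ℝ) : HasDerivAt G (r ^ (2 - 1) • g r) r := by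
    have h0 : r ^ 2 + 4 ≠ 0 := by positivity
    have h1 : HasDerivAt (fun r : ℝ ↦ r ^ 2 + 4) (2 * r) r := by
      simpa using ((hasDerivAt_id r).pow 2).add_const 4
    have h2 : HasDerivAt h (-(16 * r) / (r ^ 2 + 4) ^ 2) r := by
      refine (((hasDerivAt_const r (8 : ℝ)).div h1 h0).sub_const 1).congr_deriv ?_
      ring
    have h3 := ((((h2.const_mul T).const_sub 1).log (hTh r).1.ne').sub
      (((h2.const_mul T).const_add 1).log (hTh r).2.ne')).div_const (2 * a)
    refine h3.congr_deriv ?_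
    have h4 := (hTh r).1.ne'
    have h5 := (hTh r).2.ne'
    have h6 : 1 - T ^ 2 * h r ^ 2 = (1 - T * h r) * (1 + T * h r) := by ring
    simp only [g, sausageFactor, ← hTdef, h6, smul_eq_mul]
    norm_num
    field_simp
    ring
  have hart : Real.log (1 + T) - Real.log (1 - T) = 2 * a := by
    have h1 := Real.artanh_eq_half_log (x := T) ⟨by linarith, hT1.le⟩
    rw [hTdef, Real.artanh_tanh, ← hTdef, Real.log_div (by linarith) (by linarith)] at h1
    linarith
  have hG0 : G 0 = -1 := by
    have : h 0 = 1 := by norm_num [h]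
    simp only [G, this, mul_one]
    rw [div_eq_iff (by positivity)]
    linarith
  have hGlim : Filter.Tendsto G Filter.atTop (nhds 1) := by
    have h1 : Filter.Tendsto h Filter.atTop (nhds (0 - 1)) := by
      refine Filter.Tendsto.sub_const (Filter.Tendsto.const_div_atTop ?_ 8) 1
      exact Filter.tendsto_atTop_add_const_right _ _ (Filter.tendsto_pow_atTop (by norm_num))
    have h2 : (1 : ℝ) = (Real.log (1 - T * (0 - 1)) - Real.log (1 + T * (0 - 1))) / (2 * a) := by
      rw [eq_div_iff (by positivity), ← hart]
      ring_nf
    rw [h2]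
    refine Filter.Tendsto.div_const (Filter.Tendsto.sub ?_ ?_) _
    · exact ((h1.const_mul T).const_sub 1).log (by linarith)
    · exact ((h1.const_mul T).const_add 1).log (by linarith)
  have hcont : ContinuousWithinAt G (Ici 0) 0 := (hG 0).continuousAt.continuousWithinAt
  have hnn : ∀ r ∈ Ioi (0 : ℝ), 0 ≤ r ^ (2 - 1) • g r := fun r hr ↦
    smul_nonneg (pow_nonneg (le_of_lt hr) _) (hg0 r)
  have hfin : Module.finrank ℝ Plane = 2 := by simp
  have hint : Integrable fun y : Plane ↦ g ‖y‖ := by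
    rw [integrable_fun_norm_addHaar volume, hfin]
    exact integrableOn_Ioi_deriv_of_nonneg hcont (fun r _ ↦ hG r) hnn hGlim
  simp only [area, hsqrt]
  rw [← ofReal_integral_eq_lintegral_ofReal hint (Filter.Eventually.of_forall fun y ↦ hg0 _),
    integral_fun_norm_addHaar volume g, hfin,
    integral_Ioi_of_hasDerivAt_of_nonneg hcont (fun r _ ↦ hG r) hnn hGlim, hG0,
    measureReal_def, EuclideanSpace.volume_ball_fin_two]
  congr 1
  simp [ENNReal.toReal_ofReal Real.pi_pos.le]
  ring

/-- One even and one odd zonal eigenfunction; they are independent because their values at the two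
poles are. -/
theorem exists_two_eigenfunctions {a α : ℝ} (ha : 1 ≤ a) (ha0 : 0 < a) (hα : 0 ≤ α) :
    ∃ (μ : Fin 2 → ℝ) (u : Fin 2 → S2 → ℝ), LinearIndependent ℝ u ∧
      ∀ i, SolvesEigenEquation (sausageMetric a ha0) α (μ i) (u i) ∧
        μ i ≤ (16 * Real.pi ^ 2 + 32 * α) / a := by
  have hT := tanh_pos ha0
  have hT1 := Real.tanh_lt_one a
  set T := Real.tanh a with hTdef
  have hD {x : ℝ} (hx : x ∈ Ioo (-1 - (1 / T - 1)) (1 + (1 / T - 1))) :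
      1 - Real.tanh a ^ 2 * x ^ 2 ≠ 0 := by
    have h1 : |T * x| < 1 := by
      rw [abs_mul, abs_of_pos hT, ← lt_div_iff₀' hT]
      exact abs_lt.2 ⟨by linarith [hx.1], by linarith [hx.2]⟩
    have h2 := (sq_lt_one_iff_abs_lt_one _).2 h1
    rw [← mul_pow]
    exact (by linarith : (0 : ℝ) < 1 - (T * x) ^ 2).ne'
  -- the poles of `sausageFactor a` are at `±1 / T`, outside `[-1, 1]`
  obtain ⟨⟨μ₀, hμ₀, U₀, hU₀, hU₀1, hU₀s⟩, ⟨μ₁, hμ₁, U₁, hU₁, hU₁1, hU₁s⟩⟩ :=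
    exists_even_and_odd_solution (q := fun x ↦ α * sausageCurvature a x) (f := sausageFactor a)
      (δ := 1 / T - 1) (M := (16 * Real.pi ^ 2 + 32 * α) / a) (κ := 2 * Real.pi / a) (r := a / 2)
      (by rw [sub_pos, lt_div_iff₀ hT]; linarith) (by positivity)
      (fun x hx ↦ (contDiffAt_const.mul (contDiffAt_sausageCurvature (hD hx))).contDiffWithinAt)
      (fun x hx ↦ (contDiffAt_sausageFactor (hD hx)).contDiffWithinAt)
      (fun x ↦ by simp [sausageCurvature]) (fun x ↦ by simp [sausageFactor])
      (fun x hx ↦ by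
        have h3 : 0 ≤ 1 - Real.tanh a ^ 2 := by linarith [Real.tanh_sq_lt_one a]
        unfold sausageCurvature
        positivity)
      (by positivity) (by field_simp)
      (fun t ht ↦ lower_bound_potential ha hα ht)
  refine ⟨![μ₀, μ₁], ![fun p ↦ U₀ ((p : Space) 2), fun p ↦ U₁ ((p : Space) 2)], ?_, ?_⟩
  · rw [LinearIndependent.pair_iff]
    intro s t hst
    have hN := congrFun hst northPole
    have hS := congrFun hst (-northPole)
    simp [northPole, hU₀1, hU₁1, hU₀s, hU₁s] at hN hS
    constructor <;> linarith
  · intro i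
    fin_cases i
    · exact ⟨solvesEigenEquation_of_solvesLegendre ha0 hU₀, hμ₀.2⟩
    · exact ⟨solvesEigenEquation_of_solvesLegendre ha0 hU₁, hμ₁.2⟩

end Sausage

end SurfaceGeometry

end

theorem mainTheorem2 :
    ∃ γ : ℝ → SurfaceGeometry.RiemMetric,
      (∀ L : ℝ, 1 ≤ L →
        (∀ p, 0 < SurfaceGeometry.gaussCurvature (γ L) p) ∧
        SurfaceGeometry.area (γ L) = ENNReal.ofReal (4 * Real.pi) ∧
        SurfaceGeometry.IsRotationallySymmetricConformal (γ L)) ∧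
      ∀ α : ℝ, 0 ≤ α → ∃ C : ℝ, ∀ L : ℝ, 1 ≤ L →
        ((-(C / L) : ℝ) : EReal) ≤ SurfaceGeometry.eigenvalue (γ L) α 1 ∧
        SurfaceGeometry.eigenvalue (γ L) α 1 ≤ ((C / L : ℝ) : EReal) := by
  have hpos (L : ℝ) : 0 < max L 1 := lt_max_of_lt_right one_pos
  -- only `1 ≤ L` matters; the maximum only makes the family total
  refine ⟨fun L ↦ SurfaceGeometry.sausageMetric (max L 1) (hpos L), fun L _ ↦
    ⟨SurfaceGeometry.gaussCurvature_sausageMetric_pos _, SurfaceGeometry.area_sausageMetric _,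
      SurfaceGeometry.isRotationallySymmetricConformal_conformalMetric _ _
        (SurfaceGeometry.sausageFactor (max L 1)) fun _ ↦ rfl⟩,
    fun α hα ↦ ⟨16 * Real.pi ^ 2 + 32 * α, fun L hL ↦ ⟨?_, ?_⟩⟩⟩
  · refine le_sInf ?_
    rintro Λ ⟨μ, u, hu, hμ⟩
    have h0 : 0 ≤ μ 0 := SurfaceGeometry.nonneg_of_solvesEigenEquation
      (fun p ↦ (SurfaceGeometry.gaussCurvature_sausageMetric_pos (hpos L) p).le) hα (hμ 0).1
        (hu.ne_zero 0)
    refine le_trans ?_ (hμ 0).2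
    have : 0 ≤ (16 * Real.pi ^ 2 + 32 * α) / L := by positivity
    exact_mod_cast (by linarith : -((16 * Real.pi ^ 2 + 32 * α) / L) ≤ μ 0)
  · obtain ⟨μ, u, hu, hμ⟩ := SurfaceGeometry.exists_two_eigenfunctions (le_max_right L 1) (hpos L)
      hα
    refine sInf_le ⟨μ, u, hu, fun i ↦ ⟨(hμ i).1, ?_⟩⟩
    have := (hμ i).2
    rw [max_eq_left hL] at this
    exact_mod_cast this
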